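/- **Setting.** Let $q_0=(\frac1{\sqrt3},1)$, $q_1=(0,0)$, $q_2=(\frac2{\sqrt3},0)$, let $F_i(z)=\frac13z+\frac23q_i$ for $i=0,1,2$, $F_3(z)=\frac13z+\frac13(q_1+q_2)$, $F_4(z)=\frac13z+\frac13(q_0+q_2)$, $F_5(z)=\frac13z+\frac13(q_0+q_1)$, and let $\mathcal{SG}_3$ be the unique nonempty compact set with $\mathcal{SG}_3=\bigcup_{i=0}^5F_i\mathcal{SG}_3$. Let $V_0=\{q_0,q_1,q_2\}$, $V_{m+1}=\bigcup_iF_iV_m$, $V_*=\bigcup_mV_m$, write $x\sim_my$ if $x\ne y$ are vertices of a common $m$-cell $F_{w_1}\cdots F_{w_m}\mathcal{SG}_3$, that is, $x\neq y$ both lie in $F_{w_1}\cdots F_{w_m}V_0$, and let $$\mathcal E_m(u,v)=\Big(\frac{15}7\Big)^m\sum_{x\sim_my}(u(x)-u(y))(v(x)-v(y))$$ (each edge counted once), $\mathcal E(u,v)=\lim_m\mathcal E_m(u,v)$, and $u\in dom\,\mathcal E$ if $\sup_m\mathcal E_m(u,u)<\infty$. A function $u$ is harmonic in a relatively open set $U\subset\mathcal{SG}_3$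 ($\Delta u=0$ in $U$) if it has finite energy on every cell contained in $U$ and $\mathcal E(u,v)=0$ for every $v\in dom\,\mathcal E$ with compact support in $U$. The normal derivative at $q_0$ is $$\partial_n^\uparrow u(q_0)=\lim_{m\to\infty}\Big(\frac{15}7\Big)^m\big(2u(q_0)-u(F_0^mq_1)-u(F_0^mq_2)\big).$$ For $0<\lambda\le1$ let $\Omega_\lambda=\{(x,y)\in\mathcal{SG}_3\setminus V_0: y>1-\lambda\}$, $X_\lambda=\{(x,y)\in\mathcal{SG}_3:y=1-\lambda\}$, $\bar\Omega_\lambda=\Omega_\lambda\cup\{q_0\}\cup X_\lambda$. Write uniquely $\lambda=\sum_{k\ge1}\iota_k3^{-m_k}$ with integers $0<m_1<m_2<\cdots$ and $\iota_k\in\{1,2\}$, and put $R\lambda=\sum_{k\ge2}\iota_k3^{-(m_k-m_1)}$, $\lambda_n=R^n\lambda$, $p_i=p_i^\lambda=F_0^{m_1-1}F_iq_0$. **Lemma 3.1.** Let $0<\lambda\le1$. There is exactly one continuous function $h_0=h_0^\lambda$ on $\bar\Omega_\lambda$ that is harmonic in $\Omega_\lambda$, equal to $1$ at $q_0$ and to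 $0$ on $X_\lambda$. Moreover $h_0(p_4)=h_0(p_5)$ and $\partial_n^\uparrow h_0(q_0)$ exists; denote $\alpha(\lambda)=h_0(p_4)$ and $\eta(\lambda)=\partial_n^\uparrow h_0(q_0)$. Then $\eta(\lambda)=2(\frac{15}7)^{m_1}(1-\alpha(\lambda))$ and $$\alpha(\lambda)=\begin{cases}\dfrac1{1+\eta(R\lambda)}&\text{if }\iota_1=1,\\[2mm]\dfrac{6+6\eta(R\lambda)+\eta(R\lambda)^2}{6+15\eta(R\lambda)+3\eta(R\lambda)^2}&\text{if }\iota_1=2.\end{cases}$$ Define, with $t=(\frac{15}7)^{m_2-m_1}(1-x)$, $$T^\lambda(x)=\begin{cases}\dfrac1{1+2t}&\text{if }\iota_1=1,\\[2mm]\dfrac{3+6t+2t^2}{3+15t+6t^2}&\text{if }\iota_1=2.\end{cases}$$ Then $\alpha(\lambda)=T^\lambda(\alpha(R\lambda))$, and $$\alpha(\lambda)=\lim_{n\to\infty}T^\lambda\circ T^{\lambda_1}\circ\cdots\circ T^{\lambda_n}(0).$$ -/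

import Mathlib

open Filter Topology

namespace UpperSG3

/-! ### The level-3 Sierpinski gasket -/

/-- The three corners `q₀, q₁, q₂` of the triangle. -/
noncomputable def q : Fin 3 → ℝ × ℝ :=
  ![(1 / √3, 1), (0, 0), (2 / √3, 0)]

/-- The translation parts of the six contractions. -/
noncomputable def shift : Fin 6 → ℝ × ℝ :=
  ![(2 / 3 : ℝ) • q 0, (2 / 3 : ℝ) • q 1, (2 / 3 : ℝ) • q 2,
    (1 / 3 : ℝ) • (q 1 + q 2), (1 / 3 : ℝ) • (q 0 + q 2), (1 / 3 : ℝ) • (q 0 + q 1)]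

/-- The contractions `F₀, …, F₅` of ratio `1/3`; `Fᵢ qᵢ = qᵢ` for `i = 0, 1, 2`. -/
noncomputable def F (i : Fin 6) (z : ℝ × ℝ) : ℝ × ℝ := (1 / 3 : ℝ) • z + shift i

/-- `F_w = F_{w₁} ∘ ⋯ ∘ F_{w_m}` for a word `w = w₁ ⋯ w_m`. -/
noncomputable def Fw : List (Fin 6) → ℝ × ℝ → ℝ × ℝ
  | [] => id
  | i :: w => F i ∘ Fw w

/-- The vertex sets: `V₀ = {q₀, q₁, q₂}` and `V_{m+1} = ⋃ i, Fᵢ V_m`. -/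
def V : ℕ → Set (ℝ × ℝ)
  | 0 => Set.range q
  | m + 1 => ⋃ i, F i '' V m

/-- `V_* = ⋃ m, V_m`. -/
def Vstar : Set (ℝ × ℝ) := ⋃ m, V m

/-- The level-3 Sierpinski gasket. That it is the unique nonempty compact set `K` with
`K = ⋃ i, Fᵢ K` is proved in `SG3_spec` and `SG3_unique` below. -/
def SG3 : Set (ℝ × ℝ) := closure Vstar

theorem F_dist (i : Fin 6) (x y : ℝ × ℝ) : dist (F i x) (F i y) = 1 / 3 * dist x y := by
  unfold F
  rw [dist_add_right, dist_smul₀, Real.norm_of_nonneg (by norm_num)]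

theorem F_continuous (i : Fin 6) : Continuous (F i) := by
  unfold F; fun_prop

theorem Vstar_eq : Vstar = ⋃ i, F i '' Vstar := by
  have hq : Set.range q ⊆ ⋃ i, F i '' Set.range q := by
    rintro _ ⟨j, rfl⟩
    refine Set.mem_iUnion.2 ⟨(Fin.castLE (by norm_num) j : Fin 6), q j, ⟨j, rfl⟩, ?_⟩
    fin_cases j <;> · simp [F, shift]; rw [← add_smul]; norm_num
  unfold Vstar
  simp only [Set.image_iUnion]
  rw [Set.iUnion_comm]
  apply Set.Subset.antisymm
  · refine Set.iUnion_subset fun m => ?_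
    cases m with
    | zero => exact hq.trans (Set.subset_iUnion (fun n => ⋃ i, F i '' V n) 0)
    | succ m => exact Set.subset_iUnion (fun n => ⋃ i, F i '' V n) m
  · exact Set.iUnion_subset fun m => Set.subset_iUnion V (m + 1)

theorem SG3_spec : SG3.Nonempty ∧ IsCompact SG3 ∧ SG3 = ⋃ i, F i '' SG3 := by
  have hne : Vstar.Nonempty := ⟨q 0, Set.mem_iUnion.2 ⟨0, 0, rfl⟩⟩
  have hs3 : (1 : ℝ) ≤ √3 := by
    rw [show (1 : ℝ) = √1 by simp]; exact Real.sqrt_le_sqrt (by norm_num)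
  have hs0 : (0 : ℝ) < √3 := by linarith
  have hsub : ∀ m, V m ⊆ Set.Icc (0, 0) (2 / √3, 1) := by
    intro m
    induction m with
    | zero =>
      rintro _ ⟨j, rfl⟩
      have hp : (0 : ℝ) < (√3)⁻¹ := by positivity
      have e : (2 : ℝ) / √3 = 2 * (√3)⁻¹ := by ring
      fin_cases j <;> simp [q, Prod.le_def, e]
    | succ m ih =>
      intro x hx
      obtain ⟨i, z, hz, rfl⟩ := Set.mem_iUnion.1 hx
      obtain ⟨⟨h1, h2⟩, h3, h4⟩ := ih hz
      obtain ⟨a, b⟩ := z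
      have e : (2 : ℝ) / √3 = 2 * (√3)⁻¹ := by ring
      have hp : (0 : ℝ) < (√3)⁻¹ := by positivity
      simp only [e] at h1 h2 h3 h4 ⊢
      fin_cases i <;> simp [F, shift, q, Prod.le_def, e] <;>
        refine ⟨⟨?_, ?_⟩, ?_, ?_⟩ <;> linarith
  have hc : IsCompact SG3 := by
    refine IsCompact.of_isClosed_subset
      (isCompact_Icc (a := ((0 : ℝ), (0 : ℝ))) (b := (2 / √3, 1))) isClosed_closure ?_
    exact closure_minimal (Set.iUnion_subset hsub) isClosed_Icc
  refine ⟨hne.closure, hc, ?_⟩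
  apply Set.Subset.antisymm
  · have hcl : IsClosed (⋃ i, F i '' SG3) :=
      isClosed_iUnion_of_finite fun i => (hc.image (F_continuous i)).isClosed
    refine closure_minimal ?_ hcl
    rw [Vstar_eq]
    exact Set.iUnion_mono fun i => Set.image_mono subset_closure
  · refine Set.iUnion_subset fun i => ?_
    refine (image_closure_subset_closure_image (F_continuous i)).trans (closure_mono ?_)
    conv_rhs => rw [Vstar_eq]
    exact Set.subset_iUnion (fun i => F i '' Vstar) i

theorem SG3_unique (K : Set (ℝ × ℝ)) (hne : K.Nonempty) (hc : IsCompact K)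
    (hK : K = ⋃ i, F i '' K) : K = SG3 := by
  have key : ∀ A B : Set (ℝ × ℝ), IsCompact A → A = ⋃ i, F i '' A → B.Nonempty → IsCompact B →
      B = ⋃ i, F i '' B → A ⊆ B := by
    intro A B hA hA' hB hBc hB' x hx
    obtain ⟨b, hb⟩ := hB
    obtain ⟨C, hC⟩ := (hA.isBounded.subset_closedBall b)
    have step : ∀ n : ℕ, ∀ x ∈ A, ∃ y ∈ B, dist x y ≤ (1 / 3 : ℝ) ^ n * C := by
      intro n
      induction n with
      | zero => intro x hx; exact ⟨b, hb, by simpa using hC hx⟩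
      | succ n ih =>
        intro x hx
        rw [hA'] at hx
        obtain ⟨i, z, hz, rfl⟩ := Set.mem_iUnion.1 hx
        obtain ⟨y, hy, hd⟩ := ih z hz
        refine ⟨F i y, ?_, ?_⟩
        · rw [hB']; exact Set.mem_iUnion.2 ⟨i, y, hy, rfl⟩
        · rw [F_dist, pow_succ]; linarith
    rw [← hBc.isClosed.closure_eq, Metric.mem_closure_iff]
    intro ε hε
    have ht : Tendsto (fun n : ℕ => (1 / 3 : ℝ) ^ n * C) atTop (𝓝 0) := by
      simpa using (tendsto_pow_atTop_nhds_zero_of_lt_one (by norm_num : (0 : ℝ) ≤ 1 / 3)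
        (by norm_num)).mul_const C
    obtain ⟨n, hn⟩ := (ht.eventually (gt_mem_nhds hε)).exists
    obtain ⟨y, hy, hd⟩ := step n x hx
    exact ⟨y, hy, lt_of_le_of_lt hd hn⟩
  obtain ⟨h1, h2, h3⟩ := SG3_spec
  exact Set.Subset.antisymm (key K SG3 hc hK h1 h2 h3) (key SG3 K h2 h3 hne hc hK)

/-! ### Energy, harmonic functions, normal derivative -/

/-- The discrete resistance form `ℰ_m(u,v) = (15/7)^m ∑_{x ∼_m y} (u x - u y)(v x - v y)` on the
graph `Γ_m`. Every edge belongs to exactly one `m`-cell, so the sum over the edges (each counted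
once) is the sum over the words of length `m` of the three edges of the cell. -/
noncomputable def energy (m : ℕ) (u v : ℝ × ℝ → ℝ) : ℝ :=
  (15 / 7 : ℝ) ^ m * ∑ w : Fin m → Fin 6,
    let x := fun j => Fw (List.ofFn w) (q j)
    ((u (x 0) - u (x 1)) * (v (x 0) - v (x 1)) +
      (u (x 1) - u (x 2)) * (v (x 1) - v (x 2)) +
      (u (x 2) - u (x 0)) * (v (x 2) - v (x 0)))

/-- `u ∈ dom ℰ`. The graph energies increase with `m`, so their limit is finite if and only if they
are bounded. Only the values on `V_*` matter. -/
def FiniteEnergy (u : ℝ × ℝ → ℝ) : Prop :=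
  BddAbove (Set.range fun m => energy m u u)

/-- `Δu = 0` in the (relatively open) subset `U` of the gasket, in the weak sense: `u` has locally
finite energy in `U`, and `ℰ(u, v) = lim ℰ_m(u, v) = 0` for all `v ∈ dom ℰ` whose support is a
compact subset of `U`. The values of `u` outside `U` play no role in the limit. -/
def IsHarmonicIn (U : Set (ℝ × ℝ)) (u : ℝ × ℝ → ℝ) : Prop :=
  (∀ w : List (Fin 6), Fw w '' SG3 ⊆ U → FiniteEnergy (u ∘ Fw w)) ∧
    ∀ v : ℝ × ℝ → ℝ, FiniteEnergy v → closure {x ∈ Vstar | v x ≠ 0} ⊆ U →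
      Tendsto (fun m => energy m u v) atTop (𝓝 0)

/-- The difference quotients whose limit is the normal derivative `∂ₙ^↑ u(q₀)`. -/
noncomputable def normalQuotient (u : ℝ × ℝ → ℝ) (m : ℕ) : ℝ :=
  (15 / 7 : ℝ) ^ m * (2 * u (q 0) - u ((F 0)^[m] (q 1)) - u ((F 0)^[m] (q 2)))

/-! ### Upper domains -/

/-- `X_λ`. -/
def X (lam : ℝ) : Set (ℝ × ℝ) := {p ∈ SG3 | p.2 = 1 - lam}

/-- The upper domain `Ω_λ`. -/
def Omega (lam : ℝ) : Set (ℝ × ℝ) := {p ∈ SG3 \ V 0 | 1 - lam < p.2}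

/-- The boundary `∂Ω_λ = {q₀} ∪ X_λ`. -/
def bdry (lam : ℝ) : Set (ℝ × ℝ) := {q 0} ∪ X lam

/-- The closure `Ω_λ ∪ ∂Ω_λ`. -/
def OmegaBar (lam : ℝ) : Set (ℝ × ℝ) := Omega lam ∪ bdry lam

/-- `u` solves the Dirichlet problem on `Ω_λ` with boundary values `1` at `q₀` and `0` on `X_λ`. -/
structure IsH0 (lam : ℝ) (u : ℝ × ℝ → ℝ) : Prop where
  continuousOn : ContinuousOn u (OmegaBar lam)
  harmonic : IsHarmonicIn (Omega lam) u
  top : u (q 0) = 1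
  bottom : ∀ x ∈ X lam, u x = 0

/-- The harmonic function `h₀^λ`. Its values outside the closure of `Ω_λ` are irrelevant. -/
noncomputable def h0 (lam : ℝ) : ℝ × ℝ → ℝ := Classical.epsilon (IsH0 lam)

/-! ### The expansion `λ = ∑ ι_k 3^{-m_k}` -/

/-- `λ = ∑_{k ≥ 1} ι_k 3^{-m_k}` with `0 = m₀ < m₁ < m₂ < ⋯` and `ι_k ∈ {1, 2}`; the unused digit
`ι₀` is set to `0`. -/
structure IsExpansion (lam : ℝ) (m ι : ℕ → ℕ) : Prop where
  m_zero : m 0 = 0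
  iota_zero : ι 0 = 0
  strictMono : StrictMono m
  digit : ∀ k, ι (k + 1) = 1 ∨ ι (k + 1) = 2
  hasSum : HasSum (fun k => (ι (k + 1) : ℝ) / 3 ^ m (k + 1)) lam

theorem expansion_step (x : ℝ) (hx : 0 < x ∧ x ≤ 1) :
    ∃ k i : ℕ, ∃ y : ℝ, 1 ≤ k ∧ (i = 1 ∨ i = 2) ∧ (0 < y ∧ y ≤ 1) ∧ x = (i + y) / 3 ^ k := by
  have hex : ∃ k : ℕ, 1 < x * 3 ^ k := by
    obtain ⟨k, hk⟩ := pow_unbounded_of_one_lt (1 / x) (by norm_num : (1 : ℝ) < 3)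
    exact ⟨k, by rw [div_lt_iff₀ hx.1] at hk; linarith⟩
  classical
  obtain ⟨k, hk, hmin⟩ : ∃ k : ℕ, 1 < x * 3 ^ k ∧ ∀ j < k, ¬ 1 < x * 3 ^ j :=
    ⟨Nat.find hex, Nat.find_spec hex, fun j hj => Nat.find_min hex hj⟩
  have hk1 : 1 ≤ k := by
    rcases Nat.eq_zero_or_pos k with rfl | h
    · simp at hk; linarith
    · exact h
  have hle : x * 3 ^ k ≤ 3 := by
    have := hmin (k - 1) (by omega)
    obtain ⟨j, rfl⟩ : ∃ j, k = j + 1 := ⟨k - 1, by omega⟩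
    simp only [Nat.add_sub_cancel, not_lt] at this
    rw [pow_succ]; linarith
  have h3 : (0 : ℝ) < 3 ^ k := by positivity
  rcases le_or_gt (x * 3 ^ k) 2 with h | h
  · exact ⟨k, 1, x * 3 ^ k - 1, hk1, Or.inl rfl, ⟨by linarith, by linarith⟩, by
      field_simp; push_cast; ring⟩
  · exact ⟨k, 2, x * 3 ^ k - 2, hk1, Or.inr rfl, ⟨by linarith, by linarith⟩, by
      field_simp; push_cast; ring⟩

theorem exists_expansion (lam : ℝ) (h : 0 < lam ∧ lam ≤ 1) :
    ∃ m ι : ℕ → ℕ, IsExpansion lam m ι := by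
  choose k i y hk hi hy hxy using expansion_step
  let s : ℕ → {x : ℝ // 0 < x ∧ x ≤ 1} := fun n =>
    Nat.rec ⟨lam, h⟩ (fun _ t => ⟨y t.1 t.2, hy t.1 t.2⟩) n
  let K : ℕ → ℕ := fun n => k (s n).1 (s n).2
  let I : ℕ → ℕ := fun n => i (s n).1 (s n).2
  have hs : ∀ n, (s n).1 = (I n + (s (n + 1)).1) / 3 ^ K n := fun n => hxy (s n).1 (s n).2
  let m : ℕ → ℕ := fun n => ∑ j ∈ Finset.range n, K j
  have hm : ∀ n, m (n + 1) = m n + K n := fun n => Finset.sum_range_succ K n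
  have hK : ∀ n, 1 ≤ K n := fun n => hk _ _
  have hmono : StrictMono m := strictMono_nat_of_lt_succ fun n => by
    have := hK n; have := hm n; omega
  refine ⟨m, fun n => n.casesOn 0 I, ?_, rfl, hmono, fun n => hi _ _, ?_⟩
  · simp [m]
  · rw [hasSum_iff_tendsto_nat_of_nonneg (fun n => by positivity)]
    have hpart : ∀ n, ∑ j ∈ Finset.range n, (I j : ℝ) / 3 ^ m (j + 1)
        = lam - (s n).1 / 3 ^ m n := by
      intro n
      induction n with
      | zero => simp [m, s]
      | succ n ih =>
        rw [Finset.sum_range_succ, ih, hs n, hm n, pow_add]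
        field_simp
        ring
    have h0' : Tendsto (fun n => (s n).1 / 3 ^ m n) atTop (𝓝 0) := by
      have hg : Tendsto (fun n : ℕ => (1 / 3 : ℝ) ^ n) atTop (𝓝 0) :=
        tendsto_pow_atTop_nhds_zero_of_lt_one (by norm_num) (by norm_num)
      refine squeeze_zero (fun n => div_nonneg (s n).2.1.le (by positivity)) (fun n => ?_) hg
      rw [one_div, inv_pow, ← one_div]
      exact div_le_div₀ zero_le_one (s n).2.2 (by positivity)
        (pow_le_pow_right₀ (by norm_num) (hmono.le_apply))
    have := (tendsto_const_nhds (x := lam)).sub h0'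
    rw [sub_zero] at this
    exact this.congr fun n => (hpart n).symm

/-- Dropping the first digit of an expansion. -/
theorem IsExpansion.tail {lam : ℝ} {m ι : ℕ → ℕ} (h : IsExpansion lam m ι) :
    IsExpansion (3 ^ m 1 * lam - ι 1) (fun k => m (k + 1) - m 1)
      (fun k => k.casesOn 0 fun j => ι (j + 2)) := by
  refine ⟨by simp, rfl, ?_, fun k => h.digit (k + 1), ?_⟩
  · intro a b hab
    have h1 := h.strictMono (Nat.add_lt_add_right hab 1)
    have h2 := h.strictMono.monotone (Nat.le_add_left 1 a)
    show m (a + 1) - m 1 < m (b + 1) - m 1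
    omega
  · have h1 := ((hasSum_nat_add_iff' 1).2 h.hasSum).mul_left ((3 : ℝ) ^ m 1)
    have e : (3 : ℝ) ^ m 1 * (lam - ∑ i ∈ Finset.range 1, (ι (i + 1) : ℝ) / 3 ^ m (i + 1))
        = 3 ^ m 1 * lam - ι 1 := by
      simp; field_simp
    rw [e] at h1
    refine h1.congr_fun ?_
    intro k
    have h2 := h.strictMono.monotone (Nat.le_add_left 1 (k + 1))
    show (ι (k + 2) : ℝ) / 3 ^ (m (k + 1 + 1) - m 1) = 3 ^ m 1 * ((ι (k + 1 + 1) : ℝ) / _)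
    rw [pow_sub₀ _ (by norm_num) h2]
    field_simp

theorem IsExpansion.mem {lam : ℝ} {m ι : ℕ → ℕ} (h : IsExpansion lam m ι) :
    0 < lam ∧ lam ≤ 1 := by
  have hpos : ∀ k, 0 < (ι (k + 1) : ℝ) / 3 ^ m (k + 1) := fun k => by
    have : 0 < ι (k + 1) := by rcases h.digit k with e | e <;> omega
    positivity
  refine ⟨lt_of_lt_of_le (hpos 0) (le_hasSum h.hasSum 0 fun k _ => (hpos k).le), ?_⟩
  have hg : HasSum (fun k : ℕ => (2 / 3 : ℝ) * (1 / 3) ^ k) 1 := by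
    have := (hasSum_geometric_of_lt_one (by norm_num : (0 : ℝ) ≤ 1 / 3) (by norm_num)).mul_left
      (2 / 3 : ℝ)
    norm_num at this ⊢
    exact this
  refine hasSum_le (fun k => ?_) h.hasSum hg
  have h2 : (ι (k + 1) : ℝ) ≤ 2 := by
    rcases h.digit k with e | e <;> rw [e] <;> norm_num
  calc (ι (k + 1) : ℝ) / 3 ^ m (k + 1) ≤ 2 / 3 ^ (k + 1) :=
        div_le_div₀ (by norm_num) h2 (by positivity)
          (pow_le_pow_right₀ (by norm_num) h.strictMono.le_apply)
    _ = 2 / 3 * (1 / 3) ^ k := by rw [pow_succ, one_div, inv_pow]; field_simp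

theorem expansion_unique {lam : ℝ} {m ι m' ι' : ℕ → ℕ} (h : IsExpansion lam m ι)
    (h' : IsExpansion lam m' ι') : m = m' ∧ ι = ι' := by
  have first : ∀ {x : ℝ} {m ι m' ι' : ℕ → ℕ}, IsExpansion x m ι → IsExpansion x m' ι' →
      m 1 = m' 1 ∧ ι 1 = ι' 1 := by
    have hle : ∀ {x : ℝ} {m ι m' ι' : ℕ → ℕ}, IsExpansion x m ι → IsExpansion x m' ι' →
        m 1 ≤ m' 1 := by
      intro x m ι m' ι' h h'
      by_contra hlt
      push Not at hlt
      have t := h.tail.mem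
      have t' := h'.tail.mem
      have a : (ι 1 : ℝ) ≤ 2 := by rcases h.digit 0 with e | e <;> simp at e <;> rw [e] <;> norm_num
      have b : (1 : ℝ) ≤ ι' 1 := by
        rcases h'.digit 0 with e | e <;> simp at e <;> rw [e] <;> norm_num
      have hp : (3 : ℝ) ^ (m' 1 + 1) ≤ 3 ^ m 1 := pow_le_pow_right₀ (by norm_num) hlt
      have := mul_le_mul_of_nonneg_right hp h.mem.1.le
      rw [pow_succ] at this
      linarith [t.2, t'.1]
    intro x m ι m' ι' h h'
    have e : m 1 = m' 1 := le_antisymm (hle h h') (hle h' h)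
    refine ⟨e, ?_⟩
    have t := h.tail.mem
    have t' := h'.tail.mem
    rw [e] at t
    have l1 : (ι 1 : ℝ) < ι' 1 + 1 := by linarith [t.1, t'.2]
    have l2 : (ι' 1 : ℝ) < ι 1 + 1 := by linarith [t.2, t'.1]
    norm_cast at l1 l2
    omega
  have all : ∀ n, ∀ {x : ℝ} {m ι m' ι' : ℕ → ℕ}, IsExpansion x m ι → IsExpansion x m' ι' →
      m (n + 1) = m' (n + 1) ∧ ι (n + 1) = ι' (n + 1) := by
    intro n
    induction n with
    | zero => exact fun h h' => first h h'
    | succ n ih =>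
      intro x m ι m' ι' h h'
      obtain ⟨e1, e2⟩ := first h h'
      have t := h.tail
      rw [e1, e2] at t
      obtain ⟨f1, f2⟩ := ih t h'.tail
      have g := h.strictMono.monotone (Nat.le_add_left 1 (n + 1))
      have g' := h'.strictMono.monotone (Nat.le_add_left 1 (n + 1))
      rw [e1] at g
      exact ⟨by omega, f2⟩
  constructor <;> funext n <;> cases n with
  | zero => simp [h.m_zero, h'.m_zero, h.iota_zero, h'.iota_zero]
  | succ n => first | exact (all n h h').1 | exact (all n h h').2

open Classical in
/-- The exponents `m_k` of `λ ∈ (0, 1]`. -/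
noncomputable def mSeq (lam : ℝ) : ℕ → ℕ :=
  if h : 0 < lam ∧ lam ≤ 1 then (exists_expansion lam h).choose else fun _ => 0

open Classical in
/-- The digits `ι_k` of `λ ∈ (0, 1]`. -/
noncomputable def iota (lam : ℝ) : ℕ → ℕ :=
  if h : 0 < lam ∧ lam ≤ 1 then (exists_expansion lam h).choose_spec.choose else fun _ => 0

theorem isExpansion_mSeq (lam : ℝ) (h : 0 < lam ∧ lam ≤ 1) :
    IsExpansion lam (mSeq lam) (iota lam) := by
  unfold mSeq iota
  rw [dif_pos h, dif_pos h]
  exact (exists_expansion lam h).choose_spec.choose_spec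

/-- `Rλ = ∑_{k ≥ 2} ι_k 3^{-(m_k - m₁)}`; the exponents satisfy `m_k > m₁`. -/
noncomputable def R (lam : ℝ) : ℝ :=
  ∑' k : ℕ, (iota lam (k + 2) : ℝ) / 3 ^ (mSeq lam (k + 2) - mSeq lam 1)

/-! ### The quantities of the theorem -/

/-- `p_i^λ = F₀^{m₁ - 1} F_i q₀`. -/
noncomputable def p (lam : ℝ) (i : Fin 6) : ℝ × ℝ := (F 0)^[mSeq lam 1 - 1] (F i (q 0))

/-- `α(λ) = h₀(p₄)`. -/
noncomputable def alpha (lam : ℝ) : ℝ := h0 lam (p lam 4)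

/-- `η(λ) = ∂ₙ^↑ h₀(q₀)`. -/
noncomputable def eta (lam : ℝ) : ℝ := limUnder atTop (normalQuotient (h0 lam))

/-- The map `T^λ`. -/
noncomputable def T (lam x : ℝ) : ℝ :=
  let t := (15 / 7 : ℝ) ^ (mSeq lam 2 - mSeq lam 1) * (1 - x)
  if iota lam 1 = 1 then 1 / (1 + 2 * t)
  else (3 + 6 * t + 2 * t ^ 2) / (3 + 15 * t + 6 * t ^ 2)

/-- `T^λ ∘ T^{λ₁} ∘ ⋯ ∘ T^{λ_n}`, where `λ_n = Rⁿλ`. -/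
noncomputable def compT (lam : ℝ) : ℕ → ℝ → ℝ
  | 0 => T lam
  | n + 1 => compT lam n ∘ T (R^[n + 1] lam)

end UpperSG3

open UpperSG3

/-!
The solution `h₀^λ` is written down explicitly, cell by cell, and uniqueness comes from a maximum
principle.

*Weak and discrete harmonicity.* On a cell, the harmonic function with corner values `c` is given on
the vertices of the next level by a fixed averaging rule (`harmPts`), and its renormalized energy
against an arbitrary function `v` depends on the corner values of `v` only (`energy_harm`). Hence
pairing a weakly harmonic function with the piecewise harmonic function that equals `1` at a vertex
`x` and `0` at the other vertices of level `m` gives the discrete Laplace equation at `x`, as soon as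
the `m`-cells at `x` lie in the domain (`energy_eq_zero_of_eq_zero_of_ne`).

*Uniqueness.* If the difference of two solutions is positive somewhere, then the points where it is
large stay away from `q₀` and `X_λ` by compactness. For `m` large its maximum over the vertices of
level `m` is attained where the discrete Laplace equation holds, so all neighbours are maximal as
well; but every vertex other than `q₀` has a higher neighbour (`IsH0.le_on_Vstar`).

*Existence.* Let `a` be the first ternary digit of `λ` and `λ'` the number formed by the remaining
ones. The line `X_λ` cuts the row of `1`-cells with index `a`, each in a copy of the domain for `λ'`;
above it `h₀^λ` is harmonic on the cells, and in each cell of the row it is a multiple of `h₀^{λ'}`.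
The domain thus acts on the cells above as a resistor of resistance `r = 1/η`, which obeys a
recursion `r(λ) = G_a(r(λ'))` with contractions `G_a` (`resStep`); this defines `r` (`res`), and the
flux balance at the vertices of `V₁` yields the values of `h₀^λ` there (`cutPts`). With these, the
energy of `h₀^λ` against a function `v` vanishing near `X_λ` is `v(q₀) / r(λ)` (`energy_cut`), which
is `0` when `v` vanishes at `q₀`. The oscillation on small cells tends to zero, because each nonzero
digit contributes a factor `1/2` (`cut_osc`), so the values on the vertices extend continuously.

*The formulas.* The first nonzero digit of `λ` determines `α(λ)` as a function of `r(Rλ)`, and near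
`q₀` the function is harmonic on a cell, where the difference quotients are constant. In terms of
`α` the recursion is `α(λ) = T^λ(α(Rλ))`, and `T^λ` contracts `[0, 1/2]` by `1/2` (`T_contract`).
-/

namespace UpperSG3

/-! ### Barycentric coordinates and the position of the cells -/

/-- The barycentric coordinates of a point of the plane with respect to `q₀, q₁, q₂`; the zeroth
one is the height `z.2`. -/
noncomputable def bary : Fin 3 → ℝ × ℝ → ℝ :=
  ![fun z => z.2, fun z => 1 - z.2 - (√3 * z.1 - z.2) / 2, fun z => (√3 * z.1 - z.2) / 2]

/-- Three times the barycentric coordinates of the translation part of `Fᵢ`. -/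
def offset : Fin 6 → Fin 3 → ℕ :=
  ![![2, 0, 0], ![0, 2, 0], ![0, 0, 2], ![0, 1, 1], ![1, 0, 1], ![1, 1, 0]]

/-- The closed triangle with corners `q₀, q₁, q₂`. -/
def Tri : Set (ℝ × ℝ) := {z | ∀ k, 0 ≤ bary k z}

/-- The corner `Fᵢ q_k` of a `1`-cell as one of the ten points of `V₁`, numbered row by row from
the top, each row from left to right. -/
def code : Fin 6 → Fin 3 → Fin 10 :=
  ![![0, 1, 2], ![3, 6, 7], ![5, 8, 9], ![4, 7, 8], ![2, 4, 5], ![1, 3, 4]]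

/-- The ten points of `V₁`, numbered as in `code`. -/
noncomputable def pts : Fin 10 → ℝ × ℝ :=
  ![q 0, F 0 (q 1), F 0 (q 2), F 1 (q 0), F 3 (q 0), F 2 (q 0), q 1, F 1 (q 2), F 2 (q 1), q 2]

/-- The letter of the contraction fixing the corner `q_k`. -/
def corner (k : Fin 3) : Fin 6 := Fin.castLE (by norm_num) k

theorem bary_q (k j : Fin 3) : bary k (q j) = if k = j then 1 else 0 := by
  have h : √3 ≠ 0 := by positivity
  fin_cases k <;> fin_cases j <;> simp [bary, q, h]
  all_goals field_simp
  all_goals norm_num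

theorem bary_F (k : Fin 3) (i : Fin 6) (z : ℝ × ℝ) :
    bary k (F i z) = (bary k z + offset i k) / 3 := by
  have h : √3 ≠ 0 := by positivity
  obtain ⟨x, y⟩ := z
  fin_cases k <;> fin_cases i <;> simp [bary, F, shift, q, offset] <;> field_simp <;> ring

theorem bary_sum (z : ℝ × ℝ) : bary 0 z + bary 1 z + bary 2 z = 1 := by
  simp [bary]
  ring

theorem bary_ext {z z' : ℝ × ℝ} (h : ∀ k, bary k z = bary k z') : z = z' := by
  have h0 : z.2 = z'.2 := h 0
  have h2 : (√3 * z.1 - z.2) / 2 = (√3 * z'.1 - z'.2) / 2 := h 2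
  have h3 : √3 ≠ 0 := by positivity
  refine Prod.ext (mul_left_cancel₀ h3 ?_) h0
  linarith

theorem bary_continuous (k : Fin 3) : Continuous (bary k) := by
  fin_cases k <;> simp [bary] <;> fun_prop

theorem bary_zero (z : ℝ × ℝ) : bary 0 z = z.2 := rfl

theorem bary_le_one {z : ℝ × ℝ} (hz : z ∈ Tri) (k : Fin 3) : bary k z ≤ 1 := by
  have := bary_sum z
  have h0 := hz 0
  have h1 := hz 1
  have h2 := hz 2
  fin_cases k <;> simp <;> linarith

theorem eq_q_of_bary {z : ℝ × ℝ} (hz : z ∈ Tri) {k : Fin 3} (h : 1 ≤ bary k z) : z = q k := by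
  have hs := bary_sum z
  have h0 := hz 0
  have h1 := hz 1
  have h2 := hz 2
  refine bary_ext fun l => ?_
  rw [bary_q]
  fin_cases k <;> fin_cases l <;> simp at h ⊢ <;> linarith

theorem F_injective (i : Fin 6) : Function.Injective (F i) := by
  intro z z' h
  refine bary_ext fun k => ?_
  have := congrArg (bary k) h
  rw [bary_F, bary_F] at this
  linarith

theorem F_corner_q (k : Fin 3) : F (corner k) (q k) = q k := by
  have key : ∀ k l : Fin 3, offset (corner k) l = if l = k then 2 else 0 := by decide
  refine bary_ext fun l => ?_
  rw [bary_F, bary_q, key]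
  split_ifs <;> norm_num

theorem F_q_eq_iff (i i' : Fin 6) (k k' : Fin 3) :
    F i (q k) = F i' (q k') ↔ code i k = code i' k' := by
  have key : ∀ (i i' : Fin 6) (k k' : Fin 3), code i k = code i' k' ↔
      ∀ l, (if l = k then 1 else 0) + offset i l = (if l = k' then 1 else 0) + offset i' l := by
    decide
  have e : ∀ (l k : Fin 3) (i : Fin 6),
      bary l (F i (q k)) = (((if l = k then 1 else 0) + offset i l : ℕ) : ℝ) / 3 := by
    intro l k i
    rw [bary_F, bary_q]
    push_cast
    rfl
  rw [key]
  constructor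
  · intro h l
    have := congrArg (bary l) h
    rw [e, e] at this
    have := (div_left_inj' (by norm_num : (3 : ℝ) ≠ 0)).1 this
    exact_mod_cast this
  · intro h
    refine bary_ext fun l => ?_
    rw [e, e, h l]

theorem F_q_eq_pts (i : Fin 6) (k : Fin 3) : F i (q k) = pts (code i k) := by
  have h0 := F_corner_q 0
  have h1 := F_corner_q 1
  have h2 := F_corner_q 2
  have c0 : corner 0 = 0 := rfl
  have c1 : corner 1 = 1 := rfl
  have c2 : corner 2 = 2 := rfl
  rw [c0] at h0
  rw [c1] at h1
  rw [c2] at h2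
  fin_cases i <;> fin_cases k <;> first
    | exact h0
    | exact h1
    | exact h2
    | exact (F_q_eq_iff _ _ _ _).2 (by decide)

/-- Two different `1`-cells of the triangle meet at most in a common corner. -/
theorem eq_corners_of_F_eq {i i' : Fin 6} (hi : i ≠ i') {z z' : ℝ × ℝ} (hz : z ∈ Tri)
    (hz' : z' ∈ Tri) (h : F i z = F i' z') : ∃ k k', z = q k ∧ z' = q k' := by
  have key : ∀ i i' : Fin 6, i ≠ i' → ∃ l, offset i l + 1 ≤ offset i' l := by decide
  have one : ∀ {i i' : Fin 6} {z z' : ℝ × ℝ}, i ≠ i' → z ∈ Tri → z' ∈ Tri → F i z = F i' z' →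
      ∃ k, z = q k := by
    intro i i' z z' hi hz hz' h
    obtain ⟨l, hl⟩ := key i i' hi
    have e := congrArg (bary l) h
    rw [bary_F, bary_F] at e
    have hl' : (offset i l : ℝ) + 1 ≤ offset i' l := by exact_mod_cast hl
    exact ⟨l, eq_q_of_bary hz (by linarith [hz' l])⟩
  obtain ⟨k, hk⟩ := one hi hz hz' h
  obtain ⟨k', hk'⟩ := one hi.symm hz' hz h.symm
  exact ⟨k, k', hk, hk'⟩

theorem eq_corner_of_F_eq_q {i : Fin 6} {z : ℝ × ℝ} (hz : z ∈ Tri) {k : Fin 3}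
    (h : F i z = q k) : i = corner k ∧ z = q k := by
  have key : ∀ (i : Fin 6) (k : Fin 3), offset i k ≤ 2 ∧ (2 ≤ offset i k → i = corner k) := by
    decide
  have e := congrArg (bary k) h
  rw [bary_F, bary_q, if_pos rfl] at e
  have hle : (offset i k : ℝ) ≤ 2 := by exact_mod_cast (key i k).1
  refine ⟨(key i k).2 ?_, eq_q_of_bary hz (by linarith)⟩
  have : (2 : ℝ) ≤ offset i k := by linarith [bary_le_one hz k]
  exact_mod_cast this

theorem q_mem_Tri (k : Fin 3) : q k ∈ Tri := by
  intro l
  rw [bary_q]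
  split_ifs <;> norm_num

theorem F_mem_Tri (i : Fin 6) {z : ℝ × ℝ} (hz : z ∈ Tri) : F i z ∈ Tri := by
  intro k
  rw [bary_F]
  have := hz k
  positivity

theorem Fw_mem_Tri (w : List (Fin 6)) {z : ℝ × ℝ} (hz : z ∈ Tri) : Fw w z ∈ Tri := by
  induction w with
  | nil => exact hz
  | cons i w ih => exact F_mem_Tri i ih

theorem Fw_append (w w' : List (Fin 6)) (z : ℝ × ℝ) : Fw (w ++ w') z = Fw w (Fw w' z) := by
  induction w with
  | nil => rfl
  | cons i w ih => exact congrArg (F i) ih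

theorem Fw_continuous (w : List (Fin 6)) : Continuous (Fw w) := by
  induction w with
  | nil => exact continuous_id
  | cons i w ih => exact (F_continuous i).comp ih

theorem Fw_replicate (i : Fin 6) (n : ℕ) (z : ℝ × ℝ) :
    Fw (List.replicate n i) z = (F i)^[n] z := by
  induction n with
  | zero => rfl
  | succ n ih =>
    rw [List.replicate_succ, Function.iterate_succ_apply', ← ih]
    rfl

theorem Fw_replicate_corner (k : Fin 3) (n : ℕ) :
    Fw (List.replicate n (corner k)) (q k) = q k := by
  rw [Fw_replicate]
  exact Function.iterate_fixed (F_corner_q k) n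

theorem bary_Fw_sub (w : List (Fin 6)) (k : Fin 3) (z z' : ℝ × ℝ) :
    bary k (Fw w z) - bary k (Fw w z') = (bary k z - bary k z') / 3 ^ w.length := by
  induction w with
  | nil => simp [Fw]
  | cons i w ih =>
    have e : ∀ y, Fw (i :: w) y = F i (Fw w y) := fun _ => rfl
    rw [e, e, bary_F, bary_F, List.length_cons, pow_succ, ← div_div, ← ih]
    ring

theorem height_Fw_le (w : List (Fin 6)) {z z' : ℝ × ℝ} (hz : z ∈ Tri) (hz' : z' ∈ Tri) :
    (Fw w z).2 ≤ (Fw w z').2 + 1 / 3 ^ w.length := by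
  have h := bary_Fw_sub w 0 z z'
  simp only [bary_zero] at h
  have h1 : (z.2 - z'.2) / 3 ^ w.length ≤ 1 / 3 ^ w.length := by
    gcongr
    have := bary_le_one hz 0
    have := hz' 0
    simp only [bary_zero] at *
    linarith
  linarith

theorem mem_V_iff {m : ℕ} {z : ℝ × ℝ} :
    z ∈ V m ↔ ∃ w : List (Fin 6), w.length = m ∧ ∃ j, z = Fw w (q j) := by
  induction m generalizing z with
  | zero =>
    constructor
    · rintro ⟨j, rfl⟩
      exact ⟨[], rfl, j, rfl⟩
    · rintro ⟨w, hw, j, rfl⟩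
      rw [List.length_eq_zero_iff.1 hw]
      exact ⟨j, rfl⟩
  | succ m ih =>
    constructor
    · intro h
      obtain ⟨i, y, hy, rfl⟩ := Set.mem_iUnion.1 h
      obtain ⟨w, hw, j, rfl⟩ := ih.1 hy
      exact ⟨i :: w, by simp [hw], j, rfl⟩
    · rintro ⟨w, hw, j, rfl⟩
      match w, hw with
      | i :: w, hw =>
        exact Set.mem_iUnion.2 ⟨i, Fw w (q j), ih.2 ⟨w, by simpa using hw, j, rfl⟩, rfl⟩

theorem V_finite (m : ℕ) : (V m).Finite := by
  induction m with
  | zero => exact Set.finite_range q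
  | succ m ih => exact Set.finite_iUnion fun i => ih.image _

theorem mem_Vstar_iff {z : ℝ × ℝ} : z ∈ Vstar ↔ ∃ w j, z = Fw w (q j) := by
  constructor
  · intro h
    obtain ⟨m, hm⟩ := Set.mem_iUnion.1 h
    obtain ⟨w, -, j, rfl⟩ := mem_V_iff.1 hm
    exact ⟨w, j, rfl⟩
  · rintro ⟨w, j, rfl⟩
    exact Set.mem_iUnion.2 ⟨w.length, mem_V_iff.2 ⟨w, rfl, j, rfl⟩⟩

theorem V_subset_succ (m : ℕ) : V m ⊆ V (m + 1) := by
  intro z hz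
  obtain ⟨w, hw, j, rfl⟩ := mem_V_iff.1 hz
  refine mem_V_iff.2 ⟨w ++ [corner j], by simp [hw], j, ?_⟩
  rw [Fw_append]
  exact congrArg (Fw w) (F_corner_q j).symm

theorem V_mono : Monotone V := monotone_nat_of_le_succ V_subset_succ

theorem q_mem_Vstar (j : Fin 3) : q j ∈ Vstar := mem_Vstar_iff.2 ⟨[], j, rfl⟩

theorem Fw_mem_Vstar (w : List (Fin 6)) {z : ℝ × ℝ} (hz : z ∈ Vstar) : Fw w z ∈ Vstar := by
  obtain ⟨w', j, rfl⟩ := mem_Vstar_iff.1 hz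
  exact mem_Vstar_iff.2 ⟨w ++ w', j, (Fw_append _ _ _).symm⟩

theorem Vstar_subset_SG3 : Vstar ⊆ SG3 := subset_closure

theorem Fw_mem_SG3 (w : List (Fin 6)) {z : ℝ × ℝ} (hz : z ∈ SG3) : Fw w z ∈ SG3 := by
  induction w with
  | nil => exact hz
  | cons i w ih =>
    rw [SG3_spec.2.2]
    exact Set.mem_iUnion.2 ⟨i, _, ih, rfl⟩

theorem SG3_subset_Tri : SG3 ⊆ Tri := by
  have hc : IsClosed Tri := by
    rw [show Tri = ⋂ k, {z | 0 ≤ bary k z} by ext; simp [Tri]]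
    exact isClosed_iInter fun k => isClosed_le continuous_const (bary_continuous k)
  refine closure_minimal (fun z hz => ?_) hc
  obtain ⟨w, j, rfl⟩ := mem_Vstar_iff.1 hz
  exact Fw_mem_Tri w (q_mem_Tri j)

theorem exists_Fw_of_mem_Vstar {z : ℝ × ℝ} (hz : z ∈ Vstar) (n : ℕ) :
    ∃ w : List (Fin 6), w.length = n ∧ ∃ y ∈ Vstar, z = Fw w y := by
  induction n generalizing z with
  | zero => exact ⟨[], rfl, z, hz, rfl⟩
  | succ n ih =>
    rw [Vstar_eq] at hz
    obtain ⟨i, y, hy, rfl⟩ := Set.mem_iUnion.1 hz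
    obtain ⟨w, hw, x, hx, rfl⟩ := ih hy
    exact ⟨i :: w, by simp [hw], x, hx, rfl⟩

theorem eq_q_of_Fw_eq_q {w : List (Fin 6)} {z : ℝ × ℝ} (hz : z ∈ Tri) {k : Fin 3}
    (h : Fw w z = q k) : z = q k := by
  induction w with
  | nil => exact h
  | cons i w ih => exact ih (eq_corner_of_F_eq_q (Fw_mem_Tri w hz) h).2

/-- Two different cells of the same level meet at most in a common corner. -/
theorem eq_corners_of_Fw_eq {w w' : List (Fin 6)} (hl : w.length = w'.length) (hw : w ≠ w')
    {z z' : ℝ × ℝ} (hz : z ∈ Tri) (hz' : z' ∈ Tri) (h : Fw w z = Fw w' z') :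
    ∃ k k', z = q k ∧ z' = q k' := by
  induction w generalizing w' with
  | nil => exact absurd (List.length_eq_zero_iff.1 hl.symm).symm hw
  | cons i w ih =>
    match w', hl with
    | i' :: w', hl =>
      by_cases hi : i = i'
      · subst hi
        exact ih (by simpa using hl) (fun e => hw (by rw [e])) (F_injective i h)
      · obtain ⟨k, k', hk, hk'⟩ :=
          eq_corners_of_F_eq hi (Fw_mem_Tri w hz) (Fw_mem_Tri w' hz') h
        exact ⟨k, k', eq_q_of_Fw_eq_q hz hk, eq_q_of_Fw_eq_q hz' hk'⟩

/-- Every vertex except `q₀` is a lower corner of some cell. -/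
theorem exists_lower_corner {m : ℕ} {z : ℝ × ℝ} (hz : z ∈ V m) (h0 : z ≠ q 0) :
    ∃ w : List (Fin 6), w.length = m ∧ ∃ j, j ≠ 0 ∧ z = Fw w (q j) := by
  have key : ∀ i : Fin 6, i ≠ 0 → ∃ i' j, j ≠ 0 ∧ code i 0 = code i' j := by decide
  induction m generalizing z with
  | zero =>
    obtain ⟨j, rfl⟩ := hz
    exact ⟨[], rfl, j, fun e => h0 (by rw [e]), rfl⟩
  | succ m ih =>
    obtain ⟨i, y, hy, rfl⟩ := Set.mem_iUnion.1 hz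
    by_cases hy0 : y = q 0
    · subst hy0
      have hi : i ≠ 0 := by
        rintro rfl
        exact h0 (F_corner_q 0)
      obtain ⟨i', j, hj, e⟩ := key i hi
      refine ⟨i' :: List.replicate m (corner j), by simp, j, hj, ?_⟩
      rw [(F_q_eq_iff _ _ _ _).2 e]
      exact congrArg (F i') (Fw_replicate_corner j m).symm
    · obtain ⟨w, hw, j, hj, rfl⟩ := ih hy hy0
      exact ⟨i :: w, by simp [hw], j, hj, rfl⟩

/-! ### Functions given by their corner values on the cells -/

/-- A table `g w k` of corner values is compatible if it takes equal values at those corners of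
cells and subcells that are the same point of the gasket. -/
structure Compat (g : List (Fin 6) → Fin 3 → ℝ) : Prop where
  corner : ∀ w k, g (w ++ [UpperSG3.corner k]) k = g w k
  junction : ∀ w i i' k k', code i k = code i' k' → g (w ++ [i]) k = g (w ++ [i']) k'

theorem Compat.tail {g : List (Fin 6) → Fin 3 → ℝ} (hg : Compat g) (i : Fin 6) :
    Compat fun w => g (i :: w) :=
  ⟨fun w k => hg.corner (i :: w) k, fun w => hg.junction (i :: w)⟩

theorem Compat.eq_of_Fw_eq_q {g : List (Fin 6) → Fin 3 → ℝ} (hg : Compat g)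
    {w : List (Fin 6)} {j k : Fin 3} (h : Fw w (q j) = q k) : g w j = g [] k := by
  induction w generalizing g with
  | nil =>
    by_cases hjk : j = k
    · rw [hjk]
    · have := congrArg (bary k) (show q j = q k from h)
      rw [bary_q, bary_q, if_neg (Ne.symm hjk)] at this
      simp at this
  | cons i w ih =>
    obtain ⟨rfl, h'⟩ := eq_corner_of_F_eq_q (Fw_mem_Tri w (q_mem_Tri j)) h
    exact (ih (hg.tail _) h').trans (hg.corner [] k)

theorem Compat.eq_of_length_eq {g : List (Fin 6) → Fin 3 → ℝ} (hg : Compat g)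
    {w w' : List (Fin 6)} (hl : w.length = w'.length) {j j' : Fin 3}
    (h : Fw w (q j) = Fw w' (q j')) : g w j = g w' j' := by
  induction w generalizing g w' with
  | nil =>
    rw [List.length_eq_zero_iff.1 hl.symm] at h ⊢
    exact hg.eq_of_Fw_eq_q h
  | cons i w ih =>
    match w', hl with
    | i' :: w', hl =>
      by_cases hi : i = i'
      · subst hi
        exact ih (hg.tail i) (by simpa using hl) (F_injective i h)
      · obtain ⟨k, k', hk, hk'⟩ := eq_corners_of_F_eq hi (Fw_mem_Tri w (q_mem_Tri j))
          (Fw_mem_Tri w' (q_mem_Tri j')) h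
        have h2 : F i (q k) = F i' (q k') := by
          rw [← hk, ← hk']
          exact h
        exact ((hg.tail i).eq_of_Fw_eq_q hk).trans
          ((hg.junction [] _ _ _ _ ((F_q_eq_iff _ _ _ _).1 h2)).trans
            ((hg.tail i').eq_of_Fw_eq_q hk').symm)

theorem Compat.append_replicate {g : List (Fin 6) → Fin 3 → ℝ} (hg : Compat g)
    (w : List (Fin 6)) (k : Fin 3) (n : ℕ) :
    g (w ++ List.replicate n (UpperSG3.corner k)) k = g w k := by
  induction n with
  | zero => simp
  | succ n ih => rw [List.replicate_succ', ← List.append_assoc, hg.corner, ih]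

theorem Compat.eq_of_Fw_eq {g : List (Fin 6) → Fin 3 → ℝ} (hg : Compat g)
    {w w' : List (Fin 6)} {j j' : Fin 3} (h : Fw w (q j) = Fw w' (q j')) : g w j = g w' j' := by
  rw [← hg.append_replicate w j w'.length, ← hg.append_replicate w' j' w.length]
  refine hg.eq_of_length_eq (by simp [add_comm]) ?_
  rw [Fw_append, Fw_append, Fw_replicate_corner, Fw_replicate_corner, h]

open Classical in
/-- The function on `V_*` with the corner values `g`; it is `0` outside `V_*`. -/
noncomputable def realize (g : List (Fin 6) → Fin 3 → ℝ) (z : ℝ × ℝ) : ℝ :=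
  if h : ∃ w j, z = Fw w (q j) then g h.choose h.choose_spec.choose else 0

theorem realize_apply {g : List (Fin 6) → Fin 3 → ℝ} (hg : Compat g) (w : List (Fin 6))
    (j : Fin 3) : realize g (Fw w (q j)) = g w j := by
  have h : ∃ w' j', Fw w (q j) = Fw w' (q j') := ⟨w, j, rfl⟩
  rw [realize, dif_pos h]
  exact hg.eq_of_Fw_eq h.choose_spec.choose_spec.symm

/-- Near a point `x` of the gasket all points of `V_*` lie in `n`-cells containing `x`. -/
theorem eventually_mem_common_cell (x : ℝ × ℝ) (n : ℕ) :
    ∀ᶠ y in 𝓝[Vstar] x, ∃ w : List (Fin 6), w.length = n ∧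
      (∃ a ∈ Vstar, y = Fw w a) ∧ ∃ b ∈ SG3, x = Fw w b := by
  let S : Set (List (Fin 6)) := {w | w.length = n ∧ x ∉ Fw w '' SG3}
  have hS : S.Finite := (List.finite_length_eq (Fin 6) n).subset fun w hw => hw.1
  have hC : IsClosed (⋃ w ∈ S, Fw w '' SG3) :=
    hS.isClosed_biUnion fun w _ => (SG3_spec.2.1.image (Fw_continuous w)).isClosed
  have hx : x ∈ (⋃ w ∈ S, Fw w '' SG3)ᶜ := by
    intro h
    obtain ⟨w, hw, h⟩ := Set.mem_iUnion₂.1 h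
    exact hw.2 h
  filter_upwards [self_mem_nhdsWithin, nhdsWithin_le_nhds (hC.isOpen_compl.mem_nhds hx)]
    with y hy hyC
  obtain ⟨w, hw, a, ha, rfl⟩ := exists_Fw_of_mem_Vstar hy n
  refine ⟨w, hw, ⟨a, ha, rfl⟩, ?_⟩
  by_contra hcon
  refine hyC (Set.mem_iUnion₂.2 ⟨w, ⟨hw, ?_⟩, a, Vstar_subset_SG3 ha, rfl⟩)
  rintro ⟨b, hb, e⟩
  exact hcon ⟨b, hb, e.symm⟩

/-- A function on `V_*` whose oscillation on the `n`-cells tends to zero extends continuously to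
the gasket. -/
theorem exists_continuous_extension (f : ℝ × ℝ → ℝ)
    (hf : ∀ ε > 0, ∃ n, ∀ w : List (Fin 6), w.length = n → ∀ x ∈ Vstar, ∀ y ∈ Vstar,
      |f (Fw w x) - f (Fw w y)| ≤ ε) :
    ∃ u : ℝ × ℝ → ℝ, ContinuousOn u SG3 ∧ Set.EqOn u f Vstar := by
  have hlim : ∀ x ∈ SG3, ∃ y, Tendsto f (𝓝[Vstar] x) (𝓝 y) := by
    intro x hx
    have hne : (𝓝[Vstar] x).NeBot := mem_closure_iff_nhdsWithin_neBot.1 hx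
    refine cauchy_iff_exists_le_nhds.1 (Metric.cauchy_iff.2 ⟨hne.map f, fun ε hε => ?_⟩)
    obtain ⟨n, hn⟩ := hf (ε / 3) (by positivity)
    refine ⟨_, image_mem_map (eventually_mem_common_cell x n), ?_⟩
    rintro _ ⟨y, ⟨w, hw, ⟨a, ha, rfl⟩, b, hb, hxb⟩, rfl⟩ _
      ⟨y', ⟨w', hw', ⟨a', ha', rfl⟩, b', hb', hxb'⟩, rfl⟩
    rw [Real.dist_eq]
    by_cases hww : w = w'
    · subst hww
      linarith [hn w hw a ha a' ha']
    · obtain ⟨k, k', rfl, rfl⟩ := eq_corners_of_Fw_eq (hw.trans hw'.symm) hww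
        (SG3_subset_Tri hb) (SG3_subset_Tri hb') (hxb.symm.trans hxb')
      have h1 := hn w hw a ha _ (q_mem_Vstar k)
      have h2 := hn w' hw' a' ha' _ (q_mem_Vstar k')
      rw [← hxb] at h1
      rw [← hxb'] at h2
      rw [abs_le] at h1 h2
      rw [abs_lt]
      constructor <;> linarith [h1.1, h1.2, h2.1, h2.2]
  refine ⟨extendFrom Vstar f, continuousOn_extendFrom subset_rfl hlim, fun x hx => ?_⟩
  obtain ⟨y, hy⟩ := hlim x (Vstar_subset_SG3 hx)
  rw [extendFrom_eq (Vstar_subset_SG3 hx) hy]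
  have h := hy.mono_left (pure_le_nhdsWithin hx)
  exact tendsto_nhds_unique h (tendsto_pure_nhds f x)

/-! ### Energy and harmonic extension -/

/-- The energy form of the triangle graph. -/
def triEnergy (a b : Fin 3 → ℝ) : ℝ :=
  (a 0 - a 1) * (b 0 - b 1) + (a 1 - a 2) * (b 1 - b 2) + (a 2 - a 0) * (b 2 - b 0)

/-- The values on `V₁` of the harmonic function with corner values `c`. -/
noncomputable def harmPts (c : Fin 3 → ℝ) : Fin 10 → ℝ :=
  ![c 0, (8 * c 0 + 4 * c 1 + 3 * c 2) / 15, (8 * c 0 + 4 * c 2 + 3 * c 1) / 15,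
    (8 * c 1 + 4 * c 0 + 3 * c 2) / 15, (c 0 + c 1 + c 2) / 3,
    (8 * c 2 + 4 * c 0 + 3 * c 1) / 15,
    c 1, (8 * c 1 + 4 * c 2 + 3 * c 0) / 15, (8 * c 2 + 4 * c 1 + 3 * c 0) / 15, c 2]

/-- The corner values on the cell `F_w` of the harmonic function with corner values `c`. -/
noncomputable def harm : List (Fin 6) → (Fin 3 → ℝ) → Fin 3 → ℝ
  | [], c => c
  | i :: w, c => harm w fun k => harmPts c (code i k)

theorem energy_eq_triEnergy (m : ℕ) (u v : ℝ × ℝ → ℝ) :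
    energy m u v = (15 / 7 : ℝ) ^ m * ∑ w : Fin m → Fin 6,
      triEnergy (fun j => u (Fw (List.ofFn w) (q j))) (fun j => v (Fw (List.ofFn w) (q j))) := rfl

theorem energy_zero (u v : ℝ × ℝ → ℝ) :
    energy 0 u v = triEnergy (fun j => u (q j)) (fun j => v (q j)) := by
  simp [energy_eq_triEnergy, Fw]

theorem energy_succ (m : ℕ) (u v : ℝ × ℝ → ℝ) :
    energy (m + 1) u v = 15 / 7 * ∑ i, energy m (u ∘ F i) (v ∘ F i) := by
  simp only [energy_eq_triEnergy]
  rw [← (Fin.consEquiv fun _ : Fin (m + 1) => Fin 6).sum_comp, Fintype.sum_prod_type,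
    ← Finset.mul_sum, pow_succ']
  simp [Fin.consEquiv, List.ofFn_succ, Fw, mul_assoc]

theorem energy_comm (m : ℕ) (u v : ℝ × ℝ → ℝ) : energy m u v = energy m v u := by
  simp only [energy_eq_triEnergy, triEnergy, mul_comm]

theorem energy_sub_left (m : ℕ) (u u' v : ℝ × ℝ → ℝ) :
    energy m (fun z => u z - u' z) v = energy m u v - energy m u' v := by
  simp only [energy_eq_triEnergy, triEnergy]
  rw [← mul_sub, ← Finset.sum_sub_distrib]
  congr 1
  exact Finset.sum_congr rfl fun w _ => by ring

theorem energy_smul_left (m : ℕ) (a : ℝ) (u v : ℝ × ℝ → ℝ) :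
    energy m (fun z => a * u z) v = a * energy m u v := by
  simp only [energy_eq_triEnergy, triEnergy, Finset.mul_sum]
  exact Finset.sum_congr rfl fun w _ => by ring

/-- Only the values of the first argument at the vertices matter. -/
theorem energy_congr_left (m : ℕ) {u u' : ℝ × ℝ → ℝ} (h : Set.EqOn u u' Vstar)
    (v : ℝ × ℝ → ℝ) : energy m u v = energy m u' v := by
  simp only [energy_eq_triEnergy]
  simp only [h (mem_Vstar_iff.2 ⟨_, _, rfl⟩)]

theorem energy_eq_zero_of_left (m : ℕ) {u : ℝ × ℝ → ℝ} (h : ∀ w j, u (Fw w (q j)) = 0)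
    (v : ℝ × ℝ → ℝ) : energy m u v = 0 := by
  simp [energy_eq_triEnergy, triEnergy, h]

theorem harm_append (w w' : List (Fin 6)) (c : Fin 3 → ℝ) :
    harm (w ++ w') c = harm w' (harm w c) := by
  induction w generalizing c with
  | nil => rfl
  | cons i w ih => exact ih _

theorem compat_harm (c : Fin 3 → ℝ) : Compat fun w => harm w c := by
  have hc : ∀ k (c : Fin 3 → ℝ), harmPts c (code (corner k) k) = c k := by
    intro k c
    fin_cases k <;> rfl
  refine ⟨fun w k => ?_, fun w i i' k k' h => ?_⟩
  · rw [harm_append]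
    exact hc k _
  · rw [harm_append, harm_append]
    simp only [harm, h]

/-- The renormalized energy of a harmonic function against any function is that of the corner
values: `15/7` is the renormalization constant, and the rule `harmPts` minimizes energy. -/
theorem energy_harm (m : ℕ) {u : ℝ × ℝ → ℝ} {c : Fin 3 → ℝ}
    (hu : ∀ w j, u (Fw w (q j)) = harm w c j) (v : ℝ × ℝ → ℝ) :
    energy m u v = triEnergy c fun j => v (q j) := by
  induction m generalizing u c v with
  | zero =>
    rw [energy_zero]
    congr 1
    exact funext fun j => hu [] j
  | succ m ih =>
    rw [energy_succ]
    have h : ∀ i, energy m (u ∘ F i) (v ∘ F i) =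
        triEnergy (fun k => harmPts c (code i k)) fun j => v (pts (code i j)) := by
      intro i
      rw [ih (fun w j => hu (i :: w) j)]
      simp only [Function.comp, F_q_eq_pts]
    have e0 : v (q 0) = v (pts 0) := rfl
    have e1 : v (q 1) = v (pts 6) := rfl
    have e2 : v (q 2) = v (pts 9) := rfl
    simp only [h, Fin.sum_univ_six, triEnergy, e0, e1, e2]
    simp [code, harmPts]
    ring

theorem finiteEnergy_of_eq {u : ℝ × ℝ → ℝ} {a : ℝ} {m : ℕ} (h : ∀ n, energy (m + n) u u = a) :
    FiniteEnergy u := by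
  have hfin : (Set.range fun m => energy m u u).Finite := by
    refine (((Set.finite_lt_nat m).image fun n => energy n u u).insert a).subset ?_
    rintro _ ⟨n, rfl⟩
    rcases lt_or_ge n m with hn | hn
    · exact Set.mem_insert_of_mem _ ⟨n, hn, rfl⟩
    · obtain ⟨l, rfl⟩ := Nat.exists_eq_add_of_le hn
      exact Or.inl (h l)
  exact hfin.bddAbove

theorem finiteEnergy_of_harm {u : ℝ × ℝ → ℝ} {c : Fin 3 → ℝ}
    (hu : ∀ w j, u (Fw w (q j)) = harm w c j) : FiniteEnergy u :=
  finiteEnergy_of_eq (m := 0) fun _ => energy_harm _ hu u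

/-! ### Piecewise harmonic functions -/

/-- The corner values of the function that agrees with `φ` on `V_m` and is harmonic on every
`m`-cell. -/
noncomputable def tent : ℕ → (ℝ × ℝ → ℝ) → List (Fin 6) → Fin 3 → ℝ
  | 0, φ, w => harm w fun j => φ (q j)
  | _ + 1, φ, [] => fun j => φ (q j)
  | m + 1, φ, i :: w => tent m (φ ∘ F i) w

theorem tent_nil (m : ℕ) (φ : ℝ × ℝ → ℝ) (j : Fin 3) : tent m φ [] j = φ (q j) := by
  cases m <;> rfl

theorem compat_tent (m : ℕ) (φ : ℝ × ℝ → ℝ) : Compat (tent m φ) := by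
  induction m generalizing φ with
  | zero => exact compat_harm _
  | succ m ih =>
    constructor
    · rintro (_ | ⟨i, w⟩) k
      · change tent m (φ ∘ F (corner k)) [] k = φ (q k)
        rw [tent_nil]
        exact congrArg φ (F_corner_q k)
      · exact (ih (φ ∘ F i)).corner w k
    · rintro (_ | ⟨i, w⟩) i1 i2 k1 k2 h
      · change tent m (φ ∘ F i1) [] k1 = tent m (φ ∘ F i2) [] k2
        rw [tent_nil, tent_nil]
        exact congrArg φ ((F_q_eq_iff _ _ _ _).2 h)
      · exact (ih (φ ∘ F i)).junction w _ _ _ _ h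

theorem tent_append (m : ℕ) (φ : ℝ × ℝ → ℝ) {w : List (Fin 6)} (hw : w.length = m)
    (w' : List (Fin 6)) : tent m φ (w ++ w') = harm w' fun j => φ (Fw w (q j)) := by
  induction m generalizing φ w with
  | zero =>
    rw [List.length_eq_zero_iff.1 hw]
    rfl
  | succ m ih =>
    match w, hw with
    | i :: w, hw => exact ih (φ ∘ F i) (by simpa using hw)

theorem energy_tent (m n : ℕ) {ψ φ : ℝ × ℝ → ℝ}
    (h : ∀ w j, ψ (Fw w (q j)) = tent m φ w j) (u : ℝ × ℝ → ℝ) :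
    energy (m + n) ψ u = energy m φ u := by
  induction m generalizing φ ψ u with
  | zero => rw [energy_harm _ h, energy_zero]
  | succ m ih =>
    rw [Nat.add_right_comm, energy_succ, energy_succ]
    congr 1
    exact Finset.sum_congr rfl fun i _ => ih (fun w j => h (i :: w) j) _

theorem harm_zero (w : List (Fin 6)) : harm w 0 = 0 := by
  induction w with
  | nil => rfl
  | cons i w ih =>
    have h : harmPts 0 = 0 := by
      funext n
      fin_cases n <;> simp [harmPts]
    have h' : (fun k => harmPts 0 (code i k)) = 0 := by
      rw [h]
      rfl
    rw [harm, h', ih]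

/-- If all `m`-cells at the vertex `x` lie in `U`, then a function `d` satisfying the weak Laplace
equation in `U` satisfies the discrete Laplace equation of level `m` at `x`; the latter is expressed
by pairing `d` with a function `φ` vanishing outside `x`. -/
theorem energy_eq_zero_of_eq_zero_of_ne {U : Set (ℝ × ℝ)} {d : ℝ × ℝ → ℝ}
    (hd : ∀ v : ℝ × ℝ → ℝ, FiniteEnergy v → closure {x ∈ Vstar | v x ≠ 0} ⊆ U →
      Tendsto (fun m => energy m d v) atTop (𝓝 0))
    {m : ℕ} {x : ℝ × ℝ} {φ : ℝ × ℝ → ℝ} (hφ : ∀ z, z ≠ x → φ z = 0)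
    (hx : ∀ w : List (Fin 6), w.length = m → ∀ j, x = Fw w (q j) → Fw w '' SG3 ⊆ U) :
    energy m φ d = 0 := by
  -- Test against the extension of `φ` that is harmonic on the `m`-cells.
  have hψ := realize_apply (compat_tent m φ)
  set ψ := realize (tent m φ)
  have hfin : FiniteEnergy ψ := finiteEnergy_of_eq fun n => energy_tent m n hψ ψ
  let W : Set (List (Fin 6)) := {w | w.length = m ∧ ∃ j, x = Fw w (q j)}
  have hW : W.Finite := (List.finite_length_eq (Fin 6) m).subset fun w hw => hw.1
  have hC : IsClosed (⋃ w ∈ W, Fw w '' SG3) :=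
    hW.isClosed_biUnion fun w _ => (SG3_spec.2.1.image (Fw_continuous w)).isClosed
  have hsupp : closure {x ∈ Vstar | ψ x ≠ 0} ⊆ U := by
    refine (closure_minimal ?_ hC).trans
      (Set.iUnion₂_subset fun w hw => hx w hw.1 hw.2.choose hw.2.choose_spec)
    rintro y ⟨hy, hy0⟩
    obtain ⟨w, hw, a, ha, rfl⟩ := exists_Fw_of_mem_Vstar hy m
    refine Set.mem_iUnion₂.2 ⟨w, ⟨hw, ?_⟩, a, Vstar_subset_SG3 ha, rfl⟩
    by_contra hcon
    push Not at hcon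
    obtain ⟨w', j, rfl⟩ := mem_Vstar_iff.1 ha
    refine hy0 ?_
    have h0 : (fun j => φ (Fw w (q j))) = 0 := funext fun j => hφ _ (hcon j).symm
    rw [← Fw_append, hψ, tent_append m φ hw, h0, harm_zero]
    rfl
  refine tendsto_nhds_unique (tendsto_const_nhds.congr' ?_) (hd ψ hfin hsupp)
  filter_upwards [eventually_ge_atTop m] with n hn
  obtain ⟨l, rfl⟩ := Nat.exists_eq_add_of_le hn
  rw [energy_comm (m + l) d ψ, energy_tent m l hψ]

/-! ### Maximum principle and uniqueness -/

theorem mem_OmegaBar_iff {lam : ℝ} (h0 : 0 < lam) (h1 : lam ≤ 1) {z : ℝ × ℝ} :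
    z ∈ OmegaBar lam ↔ z ∈ SG3 ∧ 1 - lam ≤ z.2 := by
  constructor
  · rintro (⟨⟨h, -⟩, h'⟩ | rfl | ⟨h, h'⟩)
    · exact ⟨h, h'.le⟩
    · exact ⟨Vstar_subset_SG3 (q_mem_Vstar 0), by simp [q]; linarith⟩
    · exact ⟨h, h'.ge⟩
  · rintro ⟨h, h'⟩
    rcases h'.eq_or_lt with e | h'
    · exact Or.inr (Or.inr ⟨h, e.symm⟩)
    · by_cases hV : z ∈ V 0
      · obtain ⟨j, rfl⟩ := hV
        have hj : j = 0 := by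
          by_contra hj
          have e := bary_q 0 j
          rw [if_neg (Ne.symm hj), bary_zero] at e
          linarith
        rw [hj]
        exact Or.inr (Or.inl rfl)
      · exact Or.inl ⟨⟨h, hV⟩, h'⟩

theorem q_zero_height : (q 0).2 = 1 := by simp [q]

theorem q_height_of_ne_zero {j : Fin 3} (hj : j ≠ 0) : (q j).2 = 0 := by
  have e := bary_q 0 j
  rwa [if_neg (Ne.symm hj), bary_zero] at e

theorem eq_q_zero_of_height {z : ℝ × ℝ} (hz : z ∈ SG3) (h : 1 ≤ z.2) : z = q 0 :=
  eq_q_of_bary (SG3_subset_Tri hz) h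

/-- A cell not contained in `Ω_λ` contains `q₀` or a point at height at most `1 - λ`. -/
theorem exists_of_not_subset_Omega {lam : ℝ} (h1 : lam ≤ 1) {w : List (Fin 6)}
    (h : ¬ Fw w '' SG3 ⊆ Omega lam) :
    ∃ a ∈ SG3, (Fw w a).2 ≤ 1 - lam ∨ 1 ≤ (Fw w a).2 := by
  obtain ⟨_, ⟨a, ha, rfl⟩, hn⟩ := Set.not_subset.1 h
  refine ⟨a, ha, ?_⟩
  by_contra hcon
  push Not at hcon
  refine hn ⟨⟨Fw_mem_SG3 w ha, ?_⟩, hcon.1⟩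
  rintro ⟨j, e⟩
  by_cases hj : j = 0
  · rw [← e, hj, q_zero_height] at hcon
    linarith [hcon.2]
  · rw [← e, q_height_of_ne_zero hj] at hcon
    linarith [hcon.1]

/-- Comparison of two solutions at the vertices: the maximum over `V_m` of a positive difference,
taken at a vertex of maximal height, would propagate to a higher neighbour. -/
theorem IsH0.le_on_Vstar {lam : ℝ} (h0 : 0 < lam) (h1 : lam ≤ 1) {u u' : ℝ × ℝ → ℝ}
    (hu : IsH0 lam u) (hu' : IsH0 lam u') {x₀ : ℝ × ℝ} (hx₀ : x₀ ∈ Vstar)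
    (hx₀' : x₀ ∈ OmegaBar lam) : u x₀ ≤ u' x₀ := by
  by_contra! hlt
  let d : ℝ × ℝ → ℝ := fun z => u z - u' z
  have hdc : ContinuousOn d (OmegaBar lam) := hu.continuousOn.sub hu'.continuousOn
  have hdh : ∀ v : ℝ × ℝ → ℝ, FiniteEnergy v → closure {x ∈ Vstar | v x ≠ 0} ⊆ Omega lam →
      Tendsto (fun m => energy m d v) atTop (𝓝 0) := by
    intro v hv hs
    have := (hu.harmonic.2 v hv hs).sub (hu'.harmonic.2 v hv hs)
    rw [sub_zero] at this
    exact this.congr fun m => (energy_sub_left m u u' v).symm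
  have hO : OmegaBar lam = SG3 ∩ {z | 1 - lam ≤ z.2} := by
    ext z
    exact mem_OmegaBar_iff h0 h1
  have hcomp : IsCompact (OmegaBar lam) := by
    rw [hO]
    exact SG3_spec.2.1.inter_right (isClosed_le continuous_const continuous_snd)
  -- The points where `d` is at least `d x₀` stay away from the boundary.
  let S : Set (ℝ × ℝ) := OmegaBar lam ∩ d ⁻¹' Set.Ici (d x₀)
  have hd0 : 0 < d x₀ := sub_pos.2 hlt
  have hS : IsCompact S :=
    hcomp.of_isClosed_subset (hdc.preimage_isClosed_of_isClosed hcomp.isClosed isClosed_Ici)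
      Set.inter_subset_left
  have hSne : S.Nonempty := ⟨x₀, hx₀', le_refl (d x₀)⟩
  have hSint : ∀ z ∈ S, 1 - lam < z.2 ∧ z.2 < 1 := by
    rintro z ⟨hz, hdz⟩
    have hpos : 0 < d z := hd0.trans_le hdz
    obtain ⟨hzK, hz2⟩ := (mem_OmegaBar_iff h0 h1).1 hz
    constructor
    · refine lt_of_le_of_ne hz2 fun e => hpos.ne' ?_
      have hX : z ∈ X lam := ⟨hzK, e.symm⟩
      change u z - u' z = 0
      rw [hu.bottom z hX, hu'.bottom z hX, sub_zero]
    · by_contra! hge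
      rw [eq_q_zero_of_height hzK hge] at hpos
      refine hpos.ne' ?_
      change u (q 0) - u' (q 0) = 0
      rw [hu.top, hu'.top, sub_self]
  obtain ⟨a, ha, hamin⟩ := hS.exists_isMinOn hSne continuous_snd.continuousOn
  obtain ⟨b, hb, hbmax⟩ := hS.exists_isMaxOn hSne continuous_snd.continuousOn
  have hδ : 0 < min (a.2 - (1 - lam)) (1 - b.2) :=
    lt_min (by linarith [(hSint a ha).1]) (by linarith [(hSint b hb).2])
  obtain ⟨m₁, hm₁⟩ := exists_pow_lt_of_lt_one hδ (by norm_num : (1 / 3 : ℝ) < 1)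
  obtain ⟨m₂, hm₂⟩ := Set.mem_iUnion.1 hx₀
  obtain ⟨m, hm, hxm⟩ : ∃ m : ℕ, (1 : ℝ) / 3 ^ m < min (a.2 - (1 - lam)) (1 - b.2) ∧ x₀ ∈ V m := by
    refine ⟨max m₁ m₂, lt_of_le_of_lt ?_ hm₁, V_mono (le_max_right _ _) hm₂⟩
    rw [← one_div_pow]
    exact pow_le_pow_of_le_one (by norm_num) (by norm_num) (le_max_left _ _)
  have hfin : (V m ∩ OmegaBar lam).Finite := (V_finite m).inter_of_left _
  obtain ⟨y, hy, hymax⟩ := Set.exists_max_image _ d hfin ⟨x₀, hxm, hx₀'⟩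
  obtain ⟨x, ⟨⟨hxV, hxO⟩, hxy⟩, hxmax⟩ := Set.exists_max_image
    {x ∈ V m ∩ OmegaBar lam | d x = d y} Prod.snd (hfin.subset fun _ h => h.1) ⟨y, hy, rfl⟩
  have hxS : x ∈ S := ⟨hxO, by
    change d x₀ ≤ d x
    rw [hxy]
    exact hymax x₀ ⟨hxm, hx₀'⟩⟩
  have hle : ∀ z ∈ V m ∩ OmegaBar lam, d z ≤ d x := fun z hz => (hymax z hz).trans hxy.ge
  have hcell : ∀ w : List (Fin 6), w.length = m → ∀ j, x = Fw w (q j) →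
      Fw w '' SG3 ⊆ Omega lam := by
    rintro w hw j hj
    by_contra hcon
    obtain ⟨c, hc, h⟩ := exists_of_not_subset_Omega h1 hcon
    have h2 := height_Fw_le w (q_mem_Tri j) (SG3_subset_Tri hc)
    have h3 := height_Fw_le w (SG3_subset_Tri hc) (q_mem_Tri j)
    rw [← hj, hw] at h2 h3
    have h4 : a.2 ≤ x.2 := hamin hxS
    have h5 : x.2 ≤ b.2 := hbmax hxS
    have h6 := hm.trans_le (min_le_left _ _)
    have h7 := hm.trans_le (min_le_right _ _)
    rcases h with h | h <;> linarith
  classical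
  let φ : ℝ × ℝ → ℝ := fun z => if z = x then 1 else 0
  have hE := energy_eq_zero_of_eq_zero_of_ne hdh (φ := φ) (fun z hz => if_neg hz) hcell
  rw [energy_eq_triEnergy, mul_eq_zero, or_iff_right (by positivity)] at hE
  -- Every edge contributes a nonnegative amount, so every edge contributes zero.
  have hedge : ∀ w : Fin m → Fin 6, ∀ j k,
      0 ≤ (φ (Fw (List.ofFn w) (q j)) - φ (Fw (List.ofFn w) (q k))) *
        (d (Fw (List.ofFn w) (q j)) - d (Fw (List.ofFn w) (q k))) := by
    have hmem : ∀ w : Fin m → Fin 6, ∀ j k, x = Fw (List.ofFn w) (q j) →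
        d (Fw (List.ofFn w) (q k)) ≤ d x := fun w j k h =>
      hle _ ⟨mem_V_iff.2 ⟨_, by simp, k, rfl⟩,
        Or.inl (hcell _ (by simp) j h ⟨q k, Vstar_subset_SG3 (q_mem_Vstar k), rfl⟩)⟩
    intro w j k
    by_cases hj : Fw (List.ofFn w) (q j) = x <;> by_cases hk : Fw (List.ofFn w) (q k) = x
    · rw [hj, hk]
      simp
    · have := hmem w j k hj.symm
      simp only [φ, if_pos hj, if_neg hk]
      rw [hj]
      linarith
    · have := hmem w k j hk.symm
      simp only [φ, if_pos hk, if_neg hj]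
      rw [hk]
      linarith
    · simp [φ, hj, hk]
  have hxq : x ≠ q 0 := by
    rintro rfl
    linarith [(hSint _ hxS).2, q_zero_height]
  obtain ⟨w, hw, j, hj0, hj⟩ := exists_lower_corner hxV hxq
  obtain ⟨w', rfl⟩ : ∃ w' : Fin m → Fin 6, w = List.ofFn w' := by
    subst hw
    exact ⟨w.get, (List.ofFn_get w).symm⟩
  have hz := (Finset.sum_eq_zero_iff_of_nonneg fun w _ =>
    add_nonneg (add_nonneg (hedge w 0 1) (hedge w 1 2)) (hedge w 2 0)).1 hE w' (Finset.mem_univ _)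
  set z := Fw (List.ofFn w') (q 0) with hzdef
  have hdiff : z.2 - x.2 = 1 / 3 ^ m := by
    have := bary_Fw_sub (List.ofFn w') 0 (q 0) (q j)
    rw [← hzdef, ← hj, bary_zero, bary_zero, bary_zero, bary_zero, q_zero_height,
      q_height_of_ne_zero hj0] at this
    simpa using this
  have hpow : (0 : ℝ) < 1 / 3 ^ m := by positivity
  have hzx : z ≠ x := fun e => by
    rw [e] at hdiff
    linarith
  have hdz : d z = d x := by
    have g01 := hedge w' 0 1
    have g12 := hedge w' 1 2
    have g20 := hedge w' 2 0
    have hφz : φ z = 0 := if_neg hzx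
    have hφx : φ x = 1 := if_pos rfl
    have hj12 : ∀ j : Fin 3, j ≠ 0 → j = 1 ∨ j = 2 := by decide
    have hz' : (φ z - φ (Fw (List.ofFn w') (q 1))) * (d z - d (Fw (List.ofFn w') (q 1))) +
        (φ (Fw (List.ofFn w') (q 1)) - φ (Fw (List.ofFn w') (q 2))) *
          (d (Fw (List.ofFn w') (q 1)) - d (Fw (List.ofFn w') (q 2))) +
        (φ (Fw (List.ofFn w') (q 2)) - φ z) * (d (Fw (List.ofFn w') (q 2)) - d z) = 0 := hz
    rcases hj12 j hj0 with rfl | rfl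
    · have e : (φ z - φ x) * (d z - d x) = 0 := by
        rw [hj]
        linarith
      rw [hφz, hφx] at e
      linarith
    · have e : (φ x - φ z) * (d x - d z) = 0 := by
        rw [hj]
        linarith
      rw [hφz, hφx] at e
      linarith
  have hzV : z ∈ V m := mem_V_iff.2 ⟨_, by simp, 0, rfl⟩
  have hzO : z ∈ OmegaBar lam :=
    Or.inl (hcell _ (by simp) j hj ⟨q 0, Vstar_subset_SG3 (q_mem_Vstar 0), rfl⟩)
  have := hxmax z ⟨⟨hzV, hzO⟩, hdz.trans hxy⟩
  linarith

theorem IsH0.eqOn {lam : ℝ} (h0 : 0 < lam) (h1 : lam ≤ 1) {u u' : ℝ × ℝ → ℝ}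
    (hu : IsH0 lam u) (hu' : IsH0 lam u') : Set.EqOn u u' (OmegaBar lam) := by
  have hV : ∀ x ∈ Vstar, x ∈ OmegaBar lam → u x = u' x := fun x hx hx' =>
    le_antisymm (hu.le_on_Vstar h0 h1 hu' hx hx') (hu'.le_on_Vstar h0 h1 hu hx hx')
  intro x hx
  obtain ⟨hxK, hx2⟩ := (mem_OmegaBar_iff h0 h1).1 hx
  rcases hx2.eq_or_lt with e | hlt
  · rw [hu.bottom x ⟨hxK, e.symm⟩, hu'.bottom x ⟨hxK, e.symm⟩]
  -- Above `X_λ` the vertices are dense.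
  have hne : (𝓝[Vstar] x).NeBot := mem_closure_iff_nhdsWithin_neBot.1 hxK
  have hmem : ∀ᶠ y in 𝓝[Vstar] x, y ∈ Vstar ∧ y ∈ OmegaBar lam := by
    filter_upwards [self_mem_nhdsWithin, nhdsWithin_le_nhds
      ((isOpen_lt continuous_const continuous_snd).mem_nhds hlt)] with y hy hy2
    exact ⟨hy, (mem_OmegaBar_iff h0 h1).2 ⟨Vstar_subset_SG3 hy, le_of_lt hy2⟩⟩
  have hle : 𝓝[Vstar] x ≤ 𝓝[OmegaBar lam] x :=
    le_inf nhdsWithin_le_nhds (le_principal_iff.2 (hmem.mono fun _ h => h.2))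
  refine tendsto_nhds_unique_of_eventuallyEq ((hu.continuousOn x hx).mono_left hle)
    ((hu'.continuousOn x hx).mono_left hle) ?_
  filter_upwards [hmem] with y hy
  exact hV y hy.1 hy.2

/-! ### Ternary digits and the effective resistance -/

/-- The first ternary digit of `x ∈ (0, 1]`, for the expansion with infinitely many nonzero
digits. -/
noncomputable def digit (x : ℝ) : ℕ := if 3 * x ≤ 1 then 0 else if 3 * x ≤ 2 then 1 else 2

/-- Removal of the first ternary digit. -/
noncomputable def next (x : ℝ) : ℝ := 3 * x - digit x

/-- The value at the two vertices of height `2/3` of the function `h₀` whose parameter has first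
digit `a`, where `r` is the effective resistance for the remaining digits. It is set to `0` if
`a = 0`, as the vertices then lie below the domain; the same applies to `lowerVal`, `centerVal`. -/
noncomputable def upperVal (a : ℕ) (r : ℝ) : ℝ :=
  if a = 0 then 0 else if a = 1 then r / (1 + r)
  else (6 * r ^ 2 + 6 * r + 1) / (6 * r ^ 2 + 15 * r + 3)

/-- The value of `h₀` at the two outer vertices of height `1/3`. -/
noncomputable def lowerVal (a : ℕ) (r : ℝ) : ℝ :=
  if a = 2 then (6 * r ^ 2 + r) / (6 * r ^ 2 + 15 * r + 3) else 0

/-- The value of `h₀` at the centre of the gasket. -/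
noncomputable def centerVal (a : ℕ) (r : ℝ) : ℝ :=
  if a = 2 then (6 * r ^ 2 + 2 * r) / (6 * r ^ 2 + 15 * r + 3) else 0

/-- The effective resistance between `q₀` and `X_λ` in terms of the first digit of `λ` and the
resistance `r` for the remaining digits. -/
noncomputable def resStep (a : ℕ) (r : ℝ) : ℝ :=
  if a = 0 then 7 / 15 * r else 7 / 30 / (1 - upperVal a r)

/-- Approximations of the effective resistance, short-circuiting the cells of level `n`. -/
noncomputable def resApprox : ℕ → ℝ → ℝ
  | 0, _ => 0
  | n + 1, x => resStep (digit x) (resApprox n (next x))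

/-- The effective resistance between `q₀` and `X_λ`; it is the reciprocal of `η(λ)`. -/
noncomputable def res (x : ℝ) : ℝ := limUnder atTop fun n => resApprox n x

theorem digit_cases (x : ℝ) : digit x = 0 ∨ digit x = 1 ∨ digit x = 2 := by
  unfold digit
  split_ifs <;> simp

theorem next_mem {x : ℝ} (hx : 0 < x ∧ x ≤ 1) : 0 < next x ∧ next x ≤ 1 := by
  unfold next digit
  split_ifs <;> push_cast <;> constructor <;> linarith

theorem digit_eq {x y : ℝ} {i : ℕ} (hi : i ≤ 2) (hy : 0 < y ∧ y ≤ 1) (h : x = (i + y) / 3) :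
    digit x = i ∧ next x = y := by
  have hd : digit x = i := by
    unfold digit
    rw [h]
    interval_cases i
    · rw [if_pos (by push_cast; linarith)]
    · rw [if_neg (by push_cast; linarith), if_pos (by push_cast; linarith)]
    · rw [if_neg (by push_cast; linarith), if_neg (by push_cast; linarith)]
  refine ⟨hd, ?_⟩
  rw [next, hd, h]
  ring

theorem resStep_one (r : ℝ) (hr : 0 ≤ r) : resStep 1 r = 7 / 30 * (1 + r) := by
  have : (1 + r) ≠ 0 := by positivity
  have e : 1 - r / (1 + r) = 1 / (1 + r) := by
    field_simp
    ring
  simp [resStep, upperVal, e]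

theorem resStep_two (r : ℝ) (hr : 0 ≤ r) :
    resStep 2 r = 7 / 30 * ((6 * r ^ 2 + 15 * r + 3) / (9 * r + 2)) := by
  have h1 : 6 * r ^ 2 + 15 * r + 3 ≠ 0 := by positivity
  have h2 : 9 * r + 2 ≠ 0 := by positivity
  have e : 1 - (6 * r ^ 2 + 6 * r + 1) / (6 * r ^ 2 + 15 * r + 3)
      = (9 * r + 2) / (6 * r ^ 2 + 15 * r + 3) := by
    field_simp
    ring
  simp only [resStep, upperVal, OfNat.ofNat_ne_zero, if_false, OfNat.ofNat_ne_one, e]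
  field_simp

theorem resStep_mem {a : ℕ} (ha : a = 0 ∨ a = 1 ∨ a = 2) {r : ℝ} (hr : 0 ≤ r ∧ r ≤ 1 / 2) :
    0 ≤ resStep a r ∧ resStep a r ≤ 1 / 2 := by
  obtain ⟨h0, h1⟩ := hr
  rcases ha with rfl | rfl | rfl
  · simp only [resStep, if_true]
    constructor <;> linarith
  · rw [resStep_one r h0]
    constructor <;> linarith
  · rw [resStep_two r h0]
    refine ⟨by positivity, ?_⟩
    rw [← mul_div_assoc, div_le_iff₀ (by positivity)]
    nlinarith

theorem resStep_lipschitz {a : ℕ} (ha : a = 0 ∨ a = 1 ∨ a = 2) {r s : ℝ} (hr : 0 ≤ r)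
    (hs : 0 ≤ s) : |resStep a r - resStep a s| ≤ 1 / 2 * |r - s| := by
  have key : ∀ k : ℝ, 0 ≤ k → k ≤ 1 / 2 → resStep a r - resStep a s = k * (r - s) →
      |resStep a r - resStep a s| ≤ 1 / 2 * |r - s| := by
    intro k h0 h1 e
    rw [e, abs_mul, abs_of_nonneg h0]
    gcongr
  rcases ha with rfl | rfl | rfl
  · refine key (7 / 15) (by norm_num) (by norm_num) ?_
    simp only [resStep, if_true]
    ring
  · refine key (7 / 30) (by norm_num) (by norm_num) ?_
    rw [resStep_one r hr, resStep_one s hs]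
    ring
  · refine key (7 / 30 * ((54 * r * s + 12 * r + 12 * s + 3) / ((9 * r + 2) * (9 * s + 2))))
      (by positivity) ?_ ?_
    · rw [← mul_div_assoc, div_le_iff₀ (by positivity)]
      nlinarith [mul_nonneg hr hs]
    · rw [resStep_two r hr, resStep_two s hs]
      field_simp
      ring

theorem resApprox_mem (n : ℕ) (x : ℝ) : 0 ≤ resApprox n x ∧ resApprox n x ≤ 1 / 2 := by
  induction n generalizing x with
  | zero => norm_num [resApprox]
  | succ n ih => exact resStep_mem (digit_cases x) (ih _)

theorem tendsto_resApprox (x : ℝ) : Tendsto (fun n => resApprox n x) atTop (𝓝 (res x)) := by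
  have h : ∀ n x, dist (resApprox n x) (resApprox (n + 1) x) ≤ 1 * (1 / 2 : ℝ) ^ n := by
    intro n
    induction n with
    | zero =>
      intro x
      have := resApprox_mem 1 x
      simp only [resApprox] at this ⊢
      rw [Real.dist_eq, zero_sub, abs_neg, abs_of_nonneg this.1]
      linarith
    | succ n ih =>
      intro x
      have h1 := resStep_lipschitz (digit_cases x) (resApprox_mem n (next x)).1
        (resApprox_mem (n + 1) (next x)).1
      have h2 := ih (next x)
      rw [Real.dist_eq] at h2 ⊢
      rw [pow_succ]
      refine h1.trans ?_
      linarith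
  exact (cauchySeq_of_le_geometric _ _ (by norm_num) fun n => h n x).tendsto_limUnder

theorem res_mem (x : ℝ) : 0 ≤ res x ∧ res x ≤ 1 / 2 :=
  ⟨ge_of_tendsto' (tendsto_resApprox x) fun n => (resApprox_mem n x).1,
    le_of_tendsto' (tendsto_resApprox x) fun n => (resApprox_mem n x).2⟩

theorem res_eq (x : ℝ) : res x = resStep (digit x) (res (next x)) := by
  refine tendsto_nhds_unique ((tendsto_add_atTop_iff_nat 1).2 (tendsto_resApprox x)) ?_
  rw [tendsto_iff_dist_tendsto_zero]
  have h := (tendsto_iff_dist_tendsto_zero.1 (tendsto_resApprox (next x))).const_mul (1 / 2)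
  rw [mul_zero] at h
  exact squeeze_zero (fun _ => dist_nonneg)
    (fun n => resStep_lipschitz (digit_cases x) (resApprox_mem n _).1 (res_mem _).1) h

/-- Induction on the number of leading zero digits. -/
theorem digit_induction {P : ℝ → Prop}
    (hzero : ∀ x, 0 < x → x ≤ 1 → digit x = 0 → P (next x) → P x)
    (hne : ∀ x, 0 < x → x ≤ 1 → digit x ≠ 0 → P x) {x : ℝ} (h0 : 0 < x) (h1 : x ≤ 1) : P x := by
  have main : ∀ (M : ℕ) (x : ℝ), 0 < x → x ≤ 1 → 1 < 3 ^ M * x → P x := by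
    intro M
    induction M with
    | zero =>
      intro x _ h1 h
      rw [pow_zero, one_mul] at h
      exact absurd h h1.not_gt
    | succ M ih =>
      intro x h0 h1 h
      by_cases hd : digit x = 0
      · have hn := next_mem ⟨h0, h1⟩
        refine hzero x h0 h1 hd (ih _ hn.1 hn.2 ?_)
        rw [next, hd, Nat.cast_zero, sub_zero, ← mul_assoc, ← pow_succ]
        exact h
      · exact hne x h0 h1 hd
  obtain ⟨M, hM⟩ := pow_unbounded_of_one_lt (1 / x) (by norm_num : (1 : ℝ) < 3)
  exact main M x h0 h1 ((div_lt_iff₀ h0).1 hM)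

theorem res_pos {x : ℝ} (h0 : 0 < x) (h1 : x ≤ 1) : 0 < res x := by
  refine digit_induction (P := fun x => 0 < res x) (fun x _ _ hd h => ?_) (fun x _ _ hd => ?_)
    h0 h1
  · rw [res_eq, hd]
    simp only [resStep, if_true]
    positivity
  · have hr := (res_mem (next x)).1
    rw [res_eq]
    rcases digit_cases x with h | h | h
    · exact absurd h hd
    · rw [h, resStep_one _ hr]
      positivity
    · rw [h, resStep_two _ hr]
      positivity

/-! ### The solution of the Dirichlet problem -/

/-- The values on `V₁` of `h₀^x`, continued by `0` below `X_x`. -/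
noncomputable def cutPts (x : ℝ) : Fin 10 → ℝ :=
  let A := upperVal (digit x) (res (next x))
  let B := lowerVal (digit x) (res (next x))
  let C := centerVal (digit x) (res (next x))
  ![1, A, A, B, C, B, 0, 0, 0, 0]

/-- The rows of the six `1`-cells, counted from the top. -/
def row : Fin 6 → ℕ := ![0, 2, 2, 2, 1, 1]

/-- The corner values of `h₀^x`, continued by `0` below `X_x`: it is harmonic on the `1`-cells in
rows above the digit of `x`, a multiple of the function for the remaining digits in the row of the
digit, and zero below. -/
noncomputable def cut : List (Fin 6) → ℝ → Fin 3 → ℝ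
  | [], _ => ![1, 0, 0]
  | i :: w, x =>
    if row i < digit x then harm w fun k => cutPts x (code i k)
    else fun k => cutPts x (code i 0) * cut w (next x) k

theorem cutPts_mem (x : ℝ) (n : Fin 10) : 0 ≤ cutPts x n ∧ cutPts x n ≤ 1 := by
  obtain ⟨h0, h1⟩ := res_mem (next x)
  have hA : 0 ≤ upperVal (digit x) (res (next x)) ∧ upperVal (digit x) (res (next x)) ≤ 1 := by
    unfold upperVal
    split_ifs
    · norm_num
    · exact ⟨by positivity, div_le_one_of_le₀ (by linarith) (by positivity)⟩
    · exact ⟨by positivity, div_le_one_of_le₀ (by linarith) (by positivity)⟩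
  have hB : 0 ≤ lowerVal (digit x) (res (next x)) ∧ lowerVal (digit x) (res (next x)) ≤ 1 := by
    unfold lowerVal
    split_ifs
    · exact ⟨by positivity, div_le_one_of_le₀ (by linarith) (by positivity)⟩
    · norm_num
  have hC : 0 ≤ centerVal (digit x) (res (next x)) ∧ centerVal (digit x) (res (next x)) ≤ 1 := by
    unfold centerVal
    split_ifs
    · exact ⟨by positivity, div_le_one_of_le₀ (by linarith) (by positivity)⟩
    · norm_num
  fin_cases n <;> simp [cutPts, hA, hB, hC]

/-- In the row of a nonzero digit the function has dropped at least by the factor `1/2`. -/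
theorem cutPts_le_half {x : ℝ} (hd : digit x ≠ 0) {i : Fin 6} (hi : ¬ row i < digit x) :
    cutPts x (code i 0) ≤ 1 / 2 := by
  obtain ⟨h0, h1⟩ := res_mem (next x)
  rcases digit_cases x with h | h | h
  · exact absurd h hd
  · have hA : upperVal 1 (res (next x)) ≤ 1 / 2 := by
      simp only [upperVal, one_ne_zero, if_false, if_true]
      rw [div_le_iff₀ (by positivity)]
      linarith
    rw [h] at hi
    fin_cases i <;> simp [row] at hi <;> simp [cutPts, code, h, lowerVal, centerVal] <;>
      linarith
  · have hB : lowerVal 2 (res (next x)) ≤ 1 / 2 := by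
      simp only [lowerVal, if_true]
      rw [div_le_iff₀ (by positivity)]
      nlinarith
    have hC : centerVal 2 (res (next x)) ≤ 1 / 2 := by
      simp only [centerVal, if_true]
      rw [div_le_iff₀ (by positivity)]
      nlinarith
    rw [h] at hi
    fin_cases i <;> simp [row] at hi <;> simp [cutPts, code, h] <;> linarith

/-- Cells below the row of the digit carry the value zero. -/
theorem cutPts_eq_zero {x : ℝ} {i : Fin 6} (hi : digit x < row i) (k : Fin 3) :
    cutPts x (code i k) = 0 := by
  rcases digit_cases x with h | h | h <;> rw [h] at hi <;>
    fin_cases i <;> simp [row] at hi <;> fin_cases k <;>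
    simp [cutPts, code, h, upperVal, lowerVal, centerVal]

/-- The lower corners of the cells in the row of the digit carry the value zero. -/
theorem cutPts_lower {x : ℝ} {i : Fin 6} (hi : ¬ row i < digit x) {k : Fin 3} (hk : k ≠ 0) :
    cutPts x (code i k) = 0 := by
  rcases digit_cases x with h | h | h <;> rw [h] at hi <;>
    fin_cases i <;> simp [row] at hi <;> fin_cases k <;> simp at hk <;>
    simp [cutPts, code, h, upperVal, lowerVal, centerVal]

theorem cut_singleton (x : ℝ) (i : Fin 6) (k : Fin 3) : cut [i] x k = cutPts x (code i k) := by
  simp only [cut]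
  split_ifs with h
  · rfl
  · by_cases hk : k = 0
    · simp [hk]
    · change cutPts x (code i 0) * (![1, 0, 0] : Fin 3 → ℝ) k = _
      rw [cutPts_lower h hk]
      have : (![1, 0, 0] : Fin 3 → ℝ) k = 0 := by
        revert hk
        fin_cases k <;> simp
      rw [this, mul_zero]

theorem compat_cut (x : ℝ) : Compat fun w => cut w x := by
  constructor
  · intro w k
    induction w generalizing x with
    | nil =>
      change cut [corner k] x k = cut [] x k
      rw [cut_singleton]
      fin_cases k <;> rfl
    | cons i w ih =>
      change cut (i :: (w ++ [corner k])) x k = cut (i :: w) x k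
      simp only [cut]
      split_ifs
      · exact (compat_harm _).corner w k
      · exact congrArg _ (ih (next x))
  · intro w i1 i2 k1 k2 hk
    induction w generalizing x with
    | nil =>
      change cut [i1] x k1 = cut [i2] x k2
      rw [cut_singleton, cut_singleton, hk]
    | cons i w ih =>
      change cut (i :: (w ++ [i1])) x k1 = cut (i :: (w ++ [i2])) x k2
      simp only [cut]
      split_ifs
      · exact (compat_harm _).junction w _ _ _ _ hk
      · exact congrArg _ (ih (next x))

theorem harmPts_mem {c : Fin 3 → ℝ} {lo hi : ℝ} (hc : ∀ k, lo ≤ c k ∧ c k ≤ hi) (n : Fin 10) :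
    lo ≤ harmPts c n ∧ harmPts c n ≤ hi := by
  obtain ⟨a0, b0⟩ := hc 0
  obtain ⟨a1, b1⟩ := hc 1
  obtain ⟨a2, b2⟩ := hc 2
  fin_cases n <;> simp [harmPts] <;> constructor <;> linarith

theorem harm_mem (w : List (Fin 6)) {c : Fin 3 → ℝ} {lo hi : ℝ}
    (hc : ∀ k, lo ≤ c k ∧ c k ≤ hi) (j : Fin 3) : lo ≤ harm w c j ∧ harm w c j ≤ hi := by
  induction w generalizing c with
  | nil => exact hc j
  | cons i w ih => exact ih fun k => harmPts_mem hc _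

/-- Passing to a subcell halves the oscillation of a harmonic function. -/
theorem harmPts_osc {c : Fin 3 → ℝ} {δ : ℝ} (hc : ∀ j k, c j - c k ≤ δ) (i : Fin 6)
    (j k : Fin 3) : harmPts c (code i j) - harmPts c (code i k) ≤ 1 / 2 * δ := by
  have h01 := hc 0 1
  have h10 := hc 1 0
  have h02 := hc 0 2
  have h20 := hc 2 0
  have h12 := hc 1 2
  have h21 := hc 2 1
  have h00 := hc 0 0
  fin_cases i <;> fin_cases j <;> fin_cases k <;> simp [harmPts, code] <;> linarith

theorem harm_osc (w : List (Fin 6)) {c : Fin 3 → ℝ} {δ : ℝ} (hc : ∀ j k, c j - c k ≤ δ)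
    (j k : Fin 3) : harm w c j - harm w c k ≤ (1 / 2) ^ w.length * δ := by
  induction w generalizing c δ with
  | nil => simpa [harm] using hc j k
  | cons i w ih =>
    have := ih (harmPts_osc hc i)
    rw [List.length_cons, pow_succ, mul_assoc]
    exact this

theorem harm_append_sub_le (w : List (Fin 6)) {c : Fin 3 → ℝ} {δ : ℝ}
    (hc : ∀ j k, c j - c k ≤ δ) (v v' : List (Fin 6)) (j j' : Fin 3) :
    harm (w ++ v) c j - harm (w ++ v') c j' ≤ 2 * ((1 / 2) ^ w.length * δ) := by
  have hosc := harm_osc w hc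
  rw [harm_append, harm_append]
  have hc' : ∀ k, harm w c 0 - (1 / 2) ^ w.length * δ ≤ harm w c k ∧
      harm w c k ≤ harm w c 0 + (1 / 2) ^ w.length * δ := fun k =>
    ⟨by linarith [hosc 0 k], by linarith [hosc k 0]⟩
  linarith [(harm_mem v hc' j).2, (harm_mem v' hc' j').1]

theorem cut_mem (w : List (Fin 6)) (x : ℝ) (j : Fin 3) : 0 ≤ cut w x j ∧ cut w x j ≤ 1 := by
  induction w generalizing x with
  | nil => fin_cases j <;> simp [cut]
  | cons i w ih =>
    simp only [cut]
    split_ifs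
    · exact harm_mem w (fun k => cutPts_mem x _) j
    · have h1 := cutPts_mem x (code i 0)
      have h2 := ih (next x)
      exact ⟨mul_nonneg h1.1 h2.1, mul_le_one₀ h1.2 h2.1 h2.2⟩

/-- The oscillation on small cells is small: each nonzero digit contributes a factor `1/2`. -/
theorem cut_osc (n : ℕ) {x : ℝ} (h0 : 0 < x) (h1 : x ≤ 1) :
    ∃ N, ∀ w : List (Fin 6), N ≤ w.length → ∀ v v' j j',
      cut (w ++ v) x j - cut (w ++ v') x j' ≤ (1 / 2) ^ n := by
  induction n generalizing x with
  | zero =>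
    refine ⟨0, fun w _ v v' j j' => ?_⟩
    linarith [(cut_mem (w ++ v) x j).2, (cut_mem (w ++ v') x j').1, pow_zero (1 / 2 : ℝ)]
  | succ n ih =>
    refine digit_induction (P := fun x => ∃ N, ∀ w : List (Fin 6), N ≤ w.length → ∀ v v' j j',
      cut (w ++ v) x j - cut (w ++ v') x j' ≤ (1 / 2) ^ (n + 1)) ?_ ?_ h0 h1
    · rintro x - - hd ⟨N, hN⟩
      refine ⟨N + 1, ?_⟩
      rintro (_ | ⟨i, w⟩) hw v v' j j'
      · simp at hw
      · simp only [List.cons_append, cut, hd, not_lt_zero, if_false]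
        have h1 := cutPts_mem x (code i 0)
        rw [← mul_sub]
        refine (mul_le_mul_of_nonneg_left (hN w (by simpa using hw) v v' j j') h1.1).trans ?_
        exact mul_le_of_le_one_left (by positivity) h1.2
    · intro x h0 h1 hd
      have hn := next_mem ⟨h0, h1⟩
      obtain ⟨N, hN⟩ := ih hn.1 hn.2
      refine ⟨max N (n + 2) + 1, ?_⟩
      rintro (_ | ⟨i, w⟩) hw v v' j j'
      · simp at hw
      · have hw' : max N (n + 2) ≤ w.length := by simpa using hw
        simp only [List.cons_append, cut]
        split_ifs with hi
        · have hc : ∀ j k, cutPts x (code i j) - cutPts x (code i k) ≤ 1 := fun j k => by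
            linarith [(cutPts_mem x (code i j)).2, (cutPts_mem x (code i k)).1]
          refine (harm_append_sub_le w hc v v' j j').trans ?_
          have : (1 / 2 : ℝ) ^ w.length ≤ (1 / 2) ^ (n + 2) :=
            pow_le_pow_of_le_one (by norm_num) (by norm_num) ((le_max_right _ _).trans hw')
          rw [pow_succ] at this
          linarith
        · rw [← mul_sub, pow_succ']
          have h3 := hN w ((le_max_left _ _).trans hw') v v' j j'
          have h4 := cutPts_le_half hd hi
          refine (mul_le_mul_of_nonneg_left h3 (cutPts_mem x _).1).trans ?_
          exact mul_le_mul_of_nonneg_right h4 (by positivity)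

theorem offset_zero_eq (i : Fin 6) : offset i 0 + row i = 2 := by
  revert i
  decide

theorem height_F (i : Fin 6) (z : ℝ × ℝ) : (F i z).2 = (z.2 + 2 - row i) / 3 := by
  have h := bary_F 0 i z
  have h2 : (offset i 0 : ℝ) + row i = 2 := by exact_mod_cast offset_zero_eq i
  rw [bary_zero, bary_zero] at h
  rw [h]
  linarith

/-- On a cell above `X_x` the function is harmonic. -/
theorem cut_append {w : List (Fin 6)} {x : ℝ} (h0 : 0 < x) (h1 : x ≤ 1)
    (hw : ∀ j, 1 - x < (Fw w (q j)).2) (v : List (Fin 6)) :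
    cut (w ++ v) x = harm v (cut w x) := by
  induction w generalizing x with
  | nil =>
    have := hw 1
    simp only [Fw, id, q_height_of_ne_zero (j := 1) (by decide)] at this
    linarith
  | cons i w ih =>
    simp only [List.cons_append, cut]
    split_ifs with hi
    · exact harm_append w v _
    · rcases (not_lt.1 hi).eq_or_lt with e | hlt
      · have hn := next_mem ⟨h0, h1⟩
        rw [ih hn.1 hn.2 fun j => ?_]
        · have harm_smul : ∀ (v : List (Fin 6)) (a : ℝ) (c : Fin 3 → ℝ),
              harm v (fun k => a * c k) = fun k => a * harm v c k := by
            intro v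
            induction v with
            | nil => exact fun _ _ => rfl
            | cons i v ih =>
              intro a c
              simp only [harm]
              rw [← ih]
              congr 1
              funext k
              generalize code i k = n
              fin_cases n <;> simp [harmPts] <;> ring
          exact (harm_smul v _ _).symm
        · have h2 := hw j
          change 1 - x < (F i (Fw w (q j))).2 at h2
          rw [height_F, ← e] at h2
          rw [next]
          linarith
      · have hz : cutPts x (code i 0) = 0 := cutPts_eq_zero hlt 0
        have h3 : (fun k => cutPts x (code i 0) * cut w (next x) k) = 0 := by
          funext k
          simp [hz]
        rw [h3, harm_zero]
        funext k
        simp [hz]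

/-- The flux of `h₀^x` leaves through `q₀`: the energy against a function vanishing near `X_x` and
below is the value at `q₀` over the resistance. -/
theorem energy_cut (m : ℕ) {x : ℝ} (h0 : 0 < x) (h1 : x ≤ 1) {u v : ℝ × ℝ → ℝ}
    (hu : ∀ w j, u (Fw w (q j)) = cut w x j)
    (hv : ∀ z ∈ Vstar, z.2 ≤ 1 - x + 1 / 3 ^ m → v z = 0) :
    energy m u v = v (q 0) / res x := by
  induction m generalizing x u v with
  | zero =>
    have hvq : ∀ j, v (q j) = 0 := fun j => hv _ (q_mem_Vstar j) (by
      have := bary_le_one (q_mem_Tri j) 0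
      rw [bary_zero] at this
      rw [pow_zero]
      linarith)
    simp [energy_zero, triEnergy, hvq]
  | succ m ih =>
    have hn := next_mem ⟨h0, h1⟩
    set r := res (next x) with hr
    have hrpos : 0 < r := res_pos hn.1 hn.2
    have habove : ∀ i, row i < digit x → energy m (u ∘ F i) (v ∘ F i) =
        triEnergy (fun k => cutPts x (code i k)) fun k => v (pts (code i k)) := by
      intro i hi
      rw [energy_harm m (c := fun k => cutPts x (code i k))]
      · simp only [Function.comp, F_q_eq_pts]
      · intro w j
        have := hu (i :: w) j
        simp only [cut, if_pos hi] at this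
        exact this
    have hbelow : ∀ i, ¬ row i < digit x → energy m (u ∘ F i) (v ∘ F i) =
        cutPts x (code i 0) * (v (pts (code i 0)) / r) := by
      intro i hi
      have hval : ∀ w j, (u ∘ F i) (Fw w (q j)) = cutPts x (code i 0) * cut w (next x) j := by
        intro w j
        have := hu (i :: w) j
        simp only [cut, if_neg hi] at this
        exact this
      rcases (not_lt.1 hi).eq_or_lt with e | hlt
      · have hreal := realize_apply (compat_cut (next x))
        set f := realize fun w => cut w (next x)
        have hEq : Set.EqOn (u ∘ F i) (fun z => cutPts x (code i 0) * f z) Vstar := by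
          intro z hz
          obtain ⟨w, j, rfl⟩ := mem_Vstar_iff.1 hz
          change (u ∘ F i) _ = cutPts x (code i 0) * f _
          rw [hval, hreal]
        rw [energy_congr_left m hEq, energy_smul_left, ih hn.1 hn.2 hreal]
        · rw [← F_q_eq_pts]
          rfl
        · intro z hz hz2
          refine hv _ (Fw_mem_Vstar [i] hz) ?_
          rw [height_F, ← e]
          rw [next] at hz2
          have : (1 : ℝ) / 3 ^ (m + 1) = 1 / 3 ^ m / 3 := by
            rw [pow_succ, div_div]
          rw [this]
          linarith
      · have hz : cutPts x (code i 0) = 0 := cutPts_eq_zero hlt 0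
        rw [hz, zero_mul]
        exact energy_eq_zero_of_left m (fun w j => by rw [hval, hz, zero_mul]) _
    rw [energy_succ, res_eq x, ← hr, Fin.sum_univ_six]
    have hD : 6 * r ^ 2 + 15 * r + 3 ≠ 0 := by positivity
    have e0 : v (q 0) = v (pts 0) := rfl
    rcases digit_cases x with hd | hd | hd
    · simp only [hbelow _ (by rw [hd]; exact Nat.not_lt_zero _)]
      simp [cutPts, code, hd, upperVal, lowerVal, centerVal, resStep, e0]
      field_simp
    · rw [habove 0 (by rw [hd]; decide), hbelow 1 (by rw [hd]; decide),
        hbelow 2 (by rw [hd]; decide), hbelow 3 (by rw [hd]; decide),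
        hbelow 4 (by rw [hd]; decide), hbelow 5 (by rw [hd]; decide), hd, resStep_one r hrpos.le]
      simp [cutPts, code, hd, upperVal, lowerVal, centerVal, triEnergy, e0, ← hr]
      field_simp
      ring
    · rw [habove 0 (by rw [hd]; decide), hbelow 1 (by rw [hd]; decide),
        hbelow 2 (by rw [hd]; decide), hbelow 3 (by rw [hd]; decide),
        habove 4 (by rw [hd]; decide), habove 5 (by rw [hd]; decide), hd, resStep_two r hrpos.le]
      simp [cutPts, code, hd, upperVal, lowerVal, centerVal, triEnergy, e0, ← hr]
      field_simp
      ring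

/-- On `X_x` and below it the corner values are zero. -/
theorem cut_eq_zero {w : List (Fin 6)} {j : Fin 3} {x : ℝ} (h0 : 0 < x) (h1 : x ≤ 1)
    (h : (Fw w (q j)).2 ≤ 1 - x) : cut w x j = 0 := by
  induction w generalizing x with
  | nil =>
    have hj : j ≠ 0 := by
      rintro rfl
      change (q 0).2 ≤ 1 - x at h
      rw [q_zero_height] at h
      linarith
    revert hj
    fin_cases j <;> simp [cut]
  | cons i w ih =>
    have hn := next_mem ⟨h0, h1⟩
    have hx : x = (digit x + next x) / 3 := by
      rw [next]
      ring
    change (F i (Fw w (q j))).2 ≤ _ at h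
    rw [height_F] at h
    simp only [cut]
    rcases lt_trichotomy (row i) (digit x) with hi | hi | hi
    · have hi' : (row i : ℝ) + 1 ≤ digit x := by exact_mod_cast hi
      have := Fw_mem_Tri w (q_mem_Tri j) 0
      rw [bary_zero] at this
      linarith
    · rw [if_neg hi.not_lt, ih hn.1 hn.2, mul_zero]
      rw [hi] at h
      linarith
    · rw [if_neg hi.not_gt, cutPts_eq_zero hi, zero_mul]

theorem dist_Fw (w : List (Fin 6)) (a b : ℝ × ℝ) :
    dist (Fw w a) (Fw w b) = (1 / 3) ^ w.length * dist a b := by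
  induction w with
  | nil => simp [Fw]
  | cons i w ih =>
    change dist (F i (Fw w a)) (F i (Fw w b)) = _
    rw [F_dist, ih, List.length_cons, pow_succ']
    ring

theorem exists_isH0 {x : ℝ} (h0 : 0 < x) (h1 : x ≤ 1) :
    ∃ u, IsH0 x u ∧ ∀ w j, u (Fw w (q j)) = cut w x j := by
  have hreal := realize_apply (compat_cut x)
  obtain ⟨u, huc, hu⟩ := exists_continuous_extension (realize fun w => cut w x) (by
    intro ε hε
    obtain ⟨n, hn⟩ := exists_pow_lt_of_lt_one hε (by norm_num : (1 / 2 : ℝ) < 1)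
    obtain ⟨N, hN⟩ := cut_osc n h0 h1
    refine ⟨N, fun w hw a ha b hb => ?_⟩
    obtain ⟨v, j, rfl⟩ := mem_Vstar_iff.1 ha
    obtain ⟨v', j', rfl⟩ := mem_Vstar_iff.1 hb
    rw [← Fw_append, ← Fw_append, hreal, hreal, abs_le]
    constructor <;> linarith [hN w hw.ge v v' j j', hN w hw.ge v' v j' j])
  have hcut : ∀ w j, u (Fw w (q j)) = cut w x j := fun w j => by
    rw [hu (mem_Vstar_iff.2 ⟨w, j, rfl⟩), hreal]
  refine ⟨u, ⟨?_, ⟨?_, ?_⟩, hcut [] 0, ?_⟩, hcut⟩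
  · exact huc.mono fun z hz => ((mem_OmegaBar_iff h0 h1).1 hz).1
  · intro w hw
    refine finiteEnergy_of_harm (c := cut w x) fun v j => ?_
    have h : ∀ j, 1 - x < (Fw w (q j)).2 := fun j =>
      (hw ⟨q j, Vstar_subset_SG3 (q_mem_Vstar j), rfl⟩).2
    rw [← cut_append h0 h1 h, ← hcut, Fw_append]
    rfl
  · intro v _ hs
    have hv0 : v (q 0) = 0 := by
      by_contra hne
      exact (hs (subset_closure ⟨q_mem_Vstar 0, hne⟩)).1.2 ⟨0, rfl⟩
    obtain ⟨δ, hδ, hδv⟩ : ∃ δ > 0, ∀ z ∈ Vstar, v z ≠ 0 → 1 - x + δ ≤ z.2 := by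
      have hK : IsCompact (closure {z ∈ Vstar | v z ≠ 0}) :=
        SG3_spec.2.1.of_isClosed_subset isClosed_closure (closure_mono fun z hz => hz.1)
      rcases Set.eq_empty_or_nonempty (closure {z ∈ Vstar | v z ≠ 0}) with he | hne
      · refine ⟨1, one_pos, fun z hz hvz => ?_⟩
        have := subset_closure (s := {z ∈ Vstar | v z ≠ 0}) ⟨hz, hvz⟩
        rw [he] at this
        exact this.elim
      · obtain ⟨a, ha, hamin⟩ := hK.exists_isMinOn hne continuous_snd.continuousOn
        refine ⟨a.2 - (1 - x), sub_pos.2 (hs ha).2, fun z hz hvz => ?_⟩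
        have : a.2 ≤ z.2 := hamin (subset_closure ⟨hz, hvz⟩)
        linarith
    obtain ⟨m, hm⟩ := exists_pow_lt_of_lt_one hδ (by norm_num : (1 / 3 : ℝ) < 1)
    refine tendsto_const_nhds.congr' ?_
    filter_upwards [eventually_ge_atTop m] with n hn
    rw [energy_cut n h0 h1 hcut, hv0, zero_div]
    intro z hz hz2
    by_contra hne
    have h2 := hδv z hz hne
    have h3 : (1 / 3 : ℝ) ^ n ≤ (1 / 3) ^ m :=
      pow_le_pow_of_le_one (by norm_num) (by norm_num) hn
    rw [one_div_pow] at h3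
    linarith
  · rintro z ⟨hzK, hz⟩
    -- The lower corners of the cells containing `z` converge to `z`, and `u` vanishes there.
    have hne : (𝓝[Vstar] z).NeBot := mem_closure_iff_nhdsWithin_neBot.1 hzK
    have hex : ∀ n : ℕ, ∃ w : List (Fin 6), w.length = n ∧ ∃ b ∈ SG3, z = Fw w b := by
      intro n
      obtain ⟨y, w, hw, -, hb⟩ := (eventually_mem_common_cell z n).exists
      exact ⟨w, hw, hb⟩
    choose w hw b hb hzb using hex
    have hmem : ∀ n, Fw (w n) (q 1) ∈ SG3 := fun n =>
      Fw_mem_SG3 _ (Vstar_subset_SG3 (q_mem_Vstar 1))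
    obtain ⟨C, hC⟩ := Metric.isBounded_iff.1 SG3_spec.2.1.isBounded
    have hlim : Tendsto (fun n => Fw (w n) (q 1)) atTop (𝓝 z) := by
      rw [tendsto_iff_dist_tendsto_zero]
      have ht : Tendsto (fun n : ℕ => (1 / 3 : ℝ) ^ n * C) atTop (𝓝 0) := by
        simpa using (tendsto_pow_atTop_nhds_zero_of_lt_one (by norm_num : (0 : ℝ) ≤ 1 / 3)
          (by norm_num)).mul_const C
      refine squeeze_zero (fun _ => dist_nonneg) (fun n => ?_) ht
      conv_lhs => rw [hzb n]
      rw [dist_Fw, hw n]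
      gcongr
      exact hC (Vstar_subset_SG3 (q_mem_Vstar 1)) (hb n)
    have hlim' : Tendsto (fun n => Fw (w n) (q 1)) atTop (𝓝[SG3] z) :=
      tendsto_nhdsWithin_iff.2 ⟨hlim, Eventually.of_forall hmem⟩
    have hu0 : ∀ n, u (Fw (w n) (q 1)) = 0 := by
      intro n
      rw [hcut]
      refine cut_eq_zero h0 h1 ?_
      have h2 := bary_Fw_sub (w n) 0 (b n) (q 1)
      rw [← hzb n, bary_zero, bary_zero, bary_zero, bary_zero, hz,
        q_height_of_ne_zero (j := 1) (by decide), sub_zero] at h2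
      have h3 : 0 ≤ (b n).2 / 3 ^ (w n).length :=
        div_nonneg (SG3_subset_Tri (hb n) 0) (by positivity)
      linarith
    exact tendsto_nhds_unique ((huc z hzK).tendsto.comp hlim')
      (tendsto_const_nhds.congr fun n => (hu0 n).symm)

/-! ### Values near the top corner -/

theorem digit_eq_zero {i : ℕ} (hi : i = 1 ∨ i = 2) {y : ℝ} (hy : 0 < y ∧ y ≤ 1) {k : ℕ}
    {x : ℝ} (hx : x = (i + y) / 3 ^ (k + 1 + 1)) :
    digit x = 0 ∧ next x = (i + y) / 3 ^ (k + 1) := by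
  have hx' : x = ((0 : ℕ) + (i + y) / 3 ^ (k + 1)) / 3 := by
    rw [hx, Nat.cast_zero, zero_add, div_div, ← pow_succ]
  have hle : (i : ℝ) ≤ 2 := by exact_mod_cast (by omega : i ≤ 2)
  have hmem : 0 < (i + y) / 3 ^ (k + 1) ∧ (i + y) / 3 ^ (k + 1) ≤ 1 := by
    refine ⟨by have := hy.1; positivity, div_le_one_of_le₀ ?_ (by positivity)⟩
    have : (1 : ℝ) ≤ 3 ^ k := one_le_pow₀ (by norm_num)
    rw [pow_succ]
    linarith [hy.2]
  exact digit_eq (Nat.zero_le 2) hmem hx'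

/-- On the topmost cell of the size of the first nonzero digit, the function is harmonic. -/
theorem cut_top {i : ℕ} (hi : i = 1 ∨ i = 2) {y : ℝ} (hy : 0 < y ∧ y ≤ 1) (k : ℕ)
    {x : ℝ} (hx : x = (i + y) / 3 ^ (k + 1)) (w : List (Fin 6)) :
    cut (List.replicate (k + 1) 0 ++ w) x =
      harm w ![1, upperVal i (res y), upperVal i (res y)] := by
  induction k generalizing x with
  | zero =>
    rw [zero_add, pow_one] at hx
    obtain ⟨hd, hn⟩ := digit_eq (by omega) hy hx
    have h0 : row 0 < digit x := by
      rw [hd]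
      change 0 < i
      omega
    change cut (0 :: w) x = _
    rw [cut, if_pos h0]
    congr 1
    funext j
    rw [cutPts, hd, hn]
    fin_cases j <;> rfl
  | succ k ih =>
    obtain ⟨hd, hn⟩ := digit_eq_zero hi hy hx
    have hr : ¬ row 0 < digit x := by
      rw [hd]
      exact Nat.not_lt_zero _
    rw [← ih rfl]
    change cut (0 :: (List.replicate (k + 1) 0 ++ w)) x = _
    rw [cut, if_neg hr, hn]
    funext j
    change 1 * _ = _
    rw [one_mul]

theorem res_eq_of_expansion {i : ℕ} (hi : i = 1 ∨ i = 2) {y : ℝ} (hy : 0 < y ∧ y ≤ 1) (k : ℕ)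
    {x : ℝ} (hx : x = (i + y) / 3 ^ (k + 1)) :
    1 / res x = 2 * (15 / 7) ^ (k + 1) * (1 - upperVal i (res y)) := by
  induction k generalizing x with
  | zero =>
    rw [zero_add, pow_one] at hx
    obtain ⟨hd, hn⟩ := digit_eq (by omega) hy hx
    have hi0 : i ≠ 0 := by omega
    rw [res_eq, hd, hn, resStep, if_neg hi0, one_div_div]
    ring
  | succ k ih =>
    obtain ⟨hd, hn⟩ := digit_eq_zero hi hy hx
    have hih := ih rfl
    rw [res_eq, hd, hn, resStep, if_pos rfl, ← one_div_mul_one_div, hih]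
    ring

theorem harm_replicate_top (l : ℕ) (c : Fin 3 → ℝ) :
    harm (List.replicate l 0) c 0 = c 0 ∧
      2 * c 0 - harm (List.replicate l 0) c 1 - harm (List.replicate l 0) c 2 =
        (7 / 15) ^ l * (2 * c 0 - c 1 - c 2) := by
  induction l generalizing c with
  | zero => simp [harm]
  | succ l ih =>
    obtain ⟨h1, h2⟩ := ih fun k => harmPts c (code 0 k)
    have e0 : harmPts c (code 0 0) = c 0 := rfl
    have e1 : harmPts c (code 0 1) = (8 * c 0 + 4 * c 1 + 3 * c 2) / 15 := rfl
    have e2 : harmPts c (code 0 2) = (8 * c 0 + 4 * c 2 + 3 * c 1) / 15 := rfl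
    rw [e0] at h1 h2
    rw [e1, e2] at h2
    rw [List.replicate_succ, harm]
    refine ⟨h1, h2.trans ?_⟩
    rw [pow_succ]
    ring

/-! ### The recursion for `α` and `η` -/

section Expansion

variable {lam : ℝ}

theorem R_eq (h : 0 < lam ∧ lam ≤ 1) : R lam = 3 ^ mSeq lam 1 * lam - iota lam 1 :=
  (isExpansion_mSeq lam h).tail.hasSum.tsum_eq

theorem R_mem (h : 0 < lam ∧ lam ≤ 1) : 0 < R lam ∧ R lam ≤ 1 := by
  rw [R_eq h]
  exact (isExpansion_mSeq lam h).tail.mem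

theorem R_iterate_mem (h : 0 < lam ∧ lam ≤ 1) (n : ℕ) : 0 < R^[n] lam ∧ R^[n] lam ≤ 1 := by
  induction n with
  | zero => exact h
  | succ n ih =>
    rw [Function.iterate_succ_apply']
    exact R_mem ih

theorem iota_one (h : 0 < lam ∧ lam ≤ 1) : iota lam 1 = 1 ∨ iota lam 1 = 2 :=
  (isExpansion_mSeq lam h).digit 0

theorem mSeq_one_pos (h : 0 < lam ∧ lam ≤ 1) : 0 < mSeq lam 1 := by
  have e := isExpansion_mSeq lam h
  have := e.strictMono zero_lt_one
  rwa [e.m_zero] at this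

theorem eq_div_pow (h : 0 < lam ∧ lam ≤ 1) :
    lam = (iota lam 1 + R lam) / 3 ^ (mSeq lam 1 - 1 + 1) := by
  rw [R_eq h, Nat.sub_add_cancel (mSeq_one_pos h)]
  field_simp
  ring

theorem mSeq_R (h : 0 < lam ∧ lam ≤ 1) : mSeq (R lam) 1 = mSeq lam 2 - mSeq lam 1 := by
  have e := (isExpansion_mSeq lam h).tail
  rw [← R_eq h] at e
  exact congrFun (expansion_unique (isExpansion_mSeq _ (R_mem h)) e).1 1

theorem isH0_h0 (h : 0 < lam ∧ lam ≤ 1) : IsH0 lam (h0 lam) := by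
  obtain ⟨u, hu, -⟩ := exists_isH0 h.1 h.2
  exact Classical.epsilon_spec ⟨u, hu⟩

theorem h0_apply (h : 0 < lam ∧ lam ≤ 1) {w : List (Fin 6)} {j : Fin 3}
    (hw : 1 - lam ≤ (Fw w (q j)).2) : h0 lam (Fw w (q j)) = cut w lam j := by
  obtain ⟨u, hu, hcut⟩ := exists_isH0 h.1 h.2
  rw [← hcut]
  exact (isH0_h0 h).eqOn h.1 h.2 hu ((mem_OmegaBar_iff h.1 h.2).2
    ⟨Vstar_subset_SG3 (mem_Vstar_iff.2 ⟨w, j, rfl⟩), hw⟩)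

theorem h0_top (h : 0 < lam ∧ lam ≤ 1) (l : ℕ) (j : Fin 3) :
    h0 lam ((F 0)^[mSeq lam 1 + l] (q j)) = harm (List.replicate l 0)
      ![1, upperVal (iota lam 1) (res (R lam)), upperVal (iota lam 1) (res (R lam))] j := by
  have hk := Nat.sub_add_cancel (mSeq_one_pos h)
  rw [← cut_top (iota_one h) (R_mem h) _ (eq_div_pow h), hk, ← List.replicate_add,
    ← Fw_replicate]
  refine h0_apply h ?_
  have h2 := height_Fw_le (List.replicate (mSeq lam 1 + l) 0) (q_mem_Tri 0) (q_mem_Tri j)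
  have h3 : Fw (List.replicate (mSeq lam 1 + l) 0) (q 0) = q 0 := Fw_replicate_corner 0 _
  rw [h3, q_zero_height, List.length_replicate] at h2
  have h4 : (1 : ℝ) / 3 ^ (mSeq lam 1 + l) ≤ lam := by
    have h5 := eq_div_pow h
    rw [hk] at h5
    refine le_of_le_of_eq ?_ h5.symm
    have h6 : (1 : ℝ) ≤ iota lam 1 := by
      rcases iota_one h with e | e <;> rw [e] <;> norm_num
    refine div_le_div₀ (by linarith [(R_mem h).1]) (by linarith [(R_mem h).1]) (by positivity) ?_
    exact pow_le_pow_right₀ (by norm_num) (Nat.le_add_right _ _)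
  linarith

theorem p_eq (h : 0 < lam ∧ lam ≤ 1) {i : Fin 6} {j : Fin 3} (hij : code i 0 = code 0 j) :
    p lam i = (F 0)^[mSeq lam 1 + 0] (q j) := by
  rw [p, (F_q_eq_iff _ _ _ _).2 hij, ← Function.iterate_succ_apply, Nat.succ_eq_add_one,
    Nat.sub_add_cancel (mSeq_one_pos h), add_zero]

theorem alpha_eq (h : 0 < lam ∧ lam ≤ 1) :
    alpha lam = upperVal (iota lam 1) (res (R lam)) := by
  rw [alpha, p_eq (i := 4) (j := 2) h (by decide), h0_top h]
  rfl

theorem h0_p_five (h : 0 < lam ∧ lam ≤ 1) : h0 lam (p lam 5) = alpha lam := by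
  rw [alpha_eq h, p_eq (i := 5) (j := 1) h (by decide), h0_top h]
  rfl

theorem one_div_res_eq (h : 0 < lam ∧ lam ≤ 1) :
    1 / res lam = 2 * (15 / 7) ^ mSeq lam 1 * (1 - alpha lam) := by
  rw [res_eq_of_expansion (iota_one h) (R_mem h) _ (eq_div_pow h), alpha_eq h,
    Nat.sub_add_cancel (mSeq_one_pos h)]

theorem tendsto_normalQuotient (h : 0 < lam ∧ lam ≤ 1) :
    Tendsto (normalQuotient (h0 lam)) atTop (𝓝 (1 / res lam)) := by
  refine tendsto_const_nhds.congr' ?_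
  filter_upwards [eventually_ge_atTop (mSeq lam 1)] with m hm
  obtain ⟨l, rfl⟩ := Nat.exists_eq_add_of_le hm
  have e := (harm_replicate_top l
    ![1, upperVal (iota lam 1) (res (R lam)), upperVal (iota lam 1) (res (R lam))]).2
  rw [← h0_top h, ← h0_top h, ← alpha_eq h] at e
  simp only [Matrix.cons_val_zero, Matrix.cons_val_one, Matrix.cons_val] at e
  have hp : (15 / 7 : ℝ) ^ l * (7 / 15) ^ l = 1 := by
    rw [← mul_pow]
    norm_num
  rw [normalQuotient, (isH0_h0 h).top, e, one_div_res_eq h, pow_add]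
  linear_combination (-(15 / 7 : ℝ) ^ mSeq lam 1 * (2 * 1 - alpha lam - alpha lam)) * hp

theorem eta_eq (h : 0 < lam ∧ lam ≤ 1) : eta lam = 1 / res lam :=
  (tendsto_normalQuotient h).limUnder_eq

theorem alpha_of_iota_one (h : 0 < lam ∧ lam ≤ 1) (hi : iota lam 1 = 1) :
    alpha lam = 1 / (1 + eta (R lam)) := by
  have hr := res_pos (R_mem h).1 (R_mem h).2
  rw [alpha_eq h, eta_eq (R_mem h), hi]
  simp only [upperVal, one_ne_zero, if_false, if_true]
  field_simp
  ring

theorem alpha_of_iota_two (h : 0 < lam ∧ lam ≤ 1) (hi : iota lam 1 = 2) :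
    alpha lam = (6 + 6 * eta (R lam) + eta (R lam) ^ 2) /
      (6 + 15 * eta (R lam) + 3 * eta (R lam) ^ 2) := by
  have hr := res_pos (R_mem h).1 (R_mem h).2
  rw [alpha_eq h, eta_eq (R_mem h), hi]
  simp only [upperVal, OfNat.ofNat_ne_zero, OfNat.ofNat_ne_one, if_false]
  field_simp

theorem alpha_eq_T (h : 0 < lam ∧ lam ≤ 1) : alpha lam = T lam (alpha (R lam)) := by
  have ht : (15 / 7 : ℝ) ^ (mSeq lam 2 - mSeq lam 1) * (1 - alpha (R lam)) = eta (R lam) / 2 := by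
    rw [eta_eq (R_mem h), one_div_res_eq (R_mem h), mSeq_R h]
    ring
  have hpos : 0 < eta (R lam) := by
    rw [eta_eq (R_mem h)]
    exact one_div_pos.2 (res_pos (R_mem h).1 (R_mem h).2)
  simp only [T, ht]
  split_ifs with hi
  · rw [alpha_of_iota_one h hi]
    congr 1
    ring
  · rw [alpha_of_iota_two h ((iota_one h).resolve_left hi)]
    field_simp
    ring

theorem alpha_mem (h : 0 < lam ∧ lam ≤ 1) : 0 ≤ alpha lam ∧ alpha lam ≤ 1 / 2 := by
  obtain ⟨h0, h1⟩ := res_mem (R lam)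
  rw [alpha_eq h]
  rcases iota_one h with e | e <;> rw [e] <;> simp only [upperVal, one_ne_zero, if_true, if_false,
    OfNat.ofNat_ne_zero, OfNat.ofNat_ne_one]
  · refine ⟨by positivity, ?_⟩
    rw [div_le_iff₀ (by positivity)]
    linarith
  · refine ⟨by positivity, ?_⟩
    rw [div_le_iff₀ (by positivity)]
    nlinarith

/-- `T^λ` maps `[0, 1/2]` into itself and contracts it by the factor `1/2`, as the variable `t`
is at least half the factor `(15/7)^{m₂ - m₁} ≥ 15/7` there. -/
theorem T_contract (h : 0 < lam ∧ lam ≤ 1) {x y : ℝ} (hx : 0 ≤ x ∧ x ≤ 1 / 2)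
    (hy : 0 ≤ y ∧ y ≤ 1 / 2) :
    (0 ≤ T lam x ∧ T lam x ≤ 1 / 2) ∧ |T lam x - T lam y| ≤ 1 / 2 * |x - y| := by
  have hs : (15 / 7 : ℝ) ≤ (15 / 7) ^ (mSeq lam 2 - mSeq lam 1) := by
    refine le_self_pow₀ (by norm_num) ?_
    rw [← mSeq_R h]
    exact (mSeq_one_pos (R_mem h)).ne'
  obtain ⟨hx0, hx1⟩ := hx
  obtain ⟨hy0, hy1⟩ := hy
  simp only [T]
  set s := (15 / 7 : ℝ) ^ (mSeq lam 2 - mSeq lam 1)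
  obtain ⟨t, ht⟩ : ∃ t, t = s * (1 - x) := ⟨_, rfl⟩
  obtain ⟨t', ht'⟩ : ∃ t', t' = s * (1 - y) := ⟨_, rfl⟩
  rw [← ht, ← ht']
  have htt : t' - t = s * (x - y) := by
    rw [ht, ht']
    ring
  have hts : s / 2 ≤ t := by
    rw [ht]
    nlinarith
  have hts' : s / 2 ≤ t' := by
    rw [ht']
    nlinarith
  have t1 : 1 ≤ t := by linarith
  have t1' : 1 ≤ t' := by linarith
  have key : ∀ k : ℝ, 0 ≤ k → k ≤ 1 / 2 → ∀ z, z = k * (x - y) → |z| ≤ 1 / 2 * |x - y| := by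
    intro k h0 h1 z e
    rw [e, abs_mul, abs_of_nonneg h0]
    gcongr
  split_ifs
  · refine ⟨⟨by positivity, ?_⟩, key (2 * s / ((1 + 2 * t) * (1 + 2 * t'))) (by positivity) ?_ _ ?_⟩
    · rw [div_le_iff₀ (by positivity)]
      linarith
    · rw [div_le_iff₀ (by positivity)]
      nlinarith
    · field_simp
      linear_combination 2 * htt
  · refine ⟨⟨by positivity, ?_⟩,
      key (s * (27 + 12 * (t + t') + 6 * (t * t')) /
        ((3 + 15 * t + 6 * t ^ 2) * (3 + 15 * t' + 6 * t' ^ 2))) (by positivity) ?_ _ ?_⟩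
    · rw [div_le_iff₀ (by positivity)]
      nlinarith
    · rw [div_le_iff₀ (by positivity)]
      have h1 : s * (27 + 12 * (t + t') + 6 * (t * t')) ≤
          (t + t') * (27 + 12 * (t + t') + 6 * (t * t')) := by
        gcongr
        linarith
      have a1 : 0 ≤ t - 1 := by linarith
      have a2 : 0 ≤ t' - 1 := by linarith
      obtain ⟨a, rfl⟩ : ∃ a, t = 1 + a := ⟨t - 1, by ring⟩
      obtain ⟨b, rfl⟩ : ∃ b, t' = 1 + b := ⟨t' - 1, by ring⟩
      have a0 : 0 ≤ a := by linarith
      have b0 : 0 ≤ b := by linarith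
      refine h1.trans (sub_nonneg.1 ?_)
      ring_nf
      positivity
    · field_simp
      linear_combination (27 + 12 * (t + t') + 6 * (t * t')) * htt

/-- Each further map in the composition halves the distance to `α`. -/
theorem abs_compT_sub_le (h : 0 < lam ∧ lam ≤ 1) (n : ℕ) {x : ℝ} (hx : 0 ≤ x ∧ x ≤ 1 / 2) :
    |compT lam n x - alpha lam| ≤ (1 / 2) ^ (n + 1) * |x - alpha (R^[n + 1] lam)| := by
  induction n generalizing x with
  | zero =>
    rw [alpha_eq_T h, zero_add, pow_one]
    exact (T_contract h hx (alpha_mem (R_mem h))).2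
  | succ n ih =>
    have hn := R_iterate_mem h (n + 1)
    have hc := T_contract hn hx (alpha_mem (R_mem hn))
    refine (ih hc.1).trans ?_
    rw [alpha_eq_T hn, pow_succ (1 / 2 : ℝ) (n + 1), mul_assoc,
      Function.iterate_succ_apply' R (n + 1)]
    exact mul_le_mul_of_nonneg_left hc.2 (by positivity)

theorem tendsto_compT (h : 0 < lam ∧ lam ≤ 1) :
    Tendsto (fun n => compT lam n 0) atTop (𝓝 (alpha lam)) := by
  rw [tendsto_iff_dist_tendsto_zero]
  have hg : Tendsto (fun n : ℕ => (1 / 2 : ℝ) ^ (n + 1)) atTop (𝓝 0) :=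
    (tendsto_add_atTop_iff_nat 1).2
      (tendsto_pow_atTop_nhds_zero_of_lt_one (by norm_num) (by norm_num))
  refine squeeze_zero (fun _ => dist_nonneg) (fun n => ?_) hg
  refine (abs_compT_sub_le h n ⟨le_rfl, by norm_num⟩).trans ?_
  have ha := alpha_mem (R_iterate_mem h (n + 1))
  rw [zero_sub, abs_neg, abs_of_nonneg ha.1]
  exact mul_le_of_le_one_right (by positivity) (by linarith)

end Expansion

end UpperSG3

theorem lemma3p1 (lam : ℝ) (hpos : 0 < lam) (hle : lam ≤ 1) :
    -- the function `h₀` exists and is unique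
    IsH0 lam (h0 lam) ∧
    (∀ u, IsH0 lam u → Set.EqOn u (h0 lam) (OmegaBar lam)) ∧
    -- `h₀(p₅) = h₀(p₄) = α(λ)`
    h0 lam (p lam 5) = alpha lam ∧
    -- the normal derivative `η(λ)` of `h₀` at `q₀` exists, and its value
    Tendsto (normalQuotient (h0 lam)) atTop (𝓝 (eta lam)) ∧
    eta lam = 2 * (15 / 7 : ℝ) ^ mSeq lam 1 * (1 - alpha lam) ∧
    -- `α(λ)` as a rational function of `η(Rλ)`
    (iota lam 1 = 1 → alpha lam = 1 / (1 + eta (R lam))) ∧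
    (iota lam 1 = 2 → alpha lam =
      (6 + 6 * eta (R lam) + eta (R lam) ^ 2) / (6 + 15 * eta (R lam) + 3 * eta (R lam) ^ 2)) ∧
    -- the recursion and the limit
    alpha lam = T lam (alpha (R lam)) ∧
    Tendsto (fun n => compT lam n 0) atTop (𝓝 (alpha lam)) := by
  have h : 0 < lam ∧ lam ≤ 1 := ⟨hpos, hle⟩
  refine ⟨isH0_h0 h, fun u hu => hu.eqOn hpos hle (isH0_h0 h), h0_p_five h, ?_, ?_,
    alpha_of_iota_one h, alpha_of_iota_two h, alpha_eq_T h, tendsto_compT h⟩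
  · rw [eta_eq h]
    exact tendsto_normalQuotient h
  · rw [eta_eq h, one_div_res_eq h]
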